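/- Graphs are undirected, finite, without multiple edges, but may contain loops. For a graph $G$ let $v(G)$ be its number of vertices, $e(G)$ its number of non-loop edges, $d_i(G)$ the degree of vertex $i$ not counting loops, $\overline d(G)=\frac1{v(G)}\sum_i d_i(G)$, $\overline{d^2}(G)=\frac1{v(G)}\sum_i d_i(G)^2$ and $\rho(G)=2e(G)/v(G)^2$. A $p$-sampling of $G$ is the random unlabeled graph obtained by including each vertex independently with probability $\min(p,1)$, taking the induced subgraph, discarding its isolated vertices (those in no edge and no loop) and forgetting the labels. A sequence $G_1,G_2,\dots$ is sampling convergent if for every $r\ge 0$ the $r/\sqrt{2e(G_j)}$-samplings of $G_j$ converge in distribution as $j\to\infty$ (on the countable discrete set of unlabeled finite graphs). A graphex is a triple $\mathcal W=(I,S,W)$ with $I\ge 0$, $S:[0,\infty)\to[0,\infty)$ measurable with $\min(S,1)$ integrable, and $W:[0,\infty)^2\to[0,1]$ symmetric and measurable such that, with $\mu_W(y)=\int W(x,y)\,dx$: $\mu_W<\infty$ a.e., $\{\mu_W>1\}$ has finite measure, $\int W(x,y)1[\mu_W(x)\le1]1[\mu_W(y)\le1]\,dx\,dy<\infty$, and $\int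 W(x,x)\,dx<\infty$. Its graphex process is $(\Gamma_s)_{s\ge 0}$, where $\Gamma_s$ is the graph, with labels in $[0,s]$ and without isolated vertices, whose edges are the atoms in $[0,s]^2$ of $$\xi=\sum_{i,j}1[\zeta_{\{i,j\}}\le W(\vartheta_i,\vartheta_j)]\delta_{(\theta_i,\theta_j)}+\sum_{j,k}1[\chi_{jk}\le S(\vartheta_j)](\delta_{(\theta_j,\sigma_{jk})}+\delta_{(\sigma_{jk},\theta_j)})+\sum_k1[\eta_k\le I](\delta_{(\rho_k,\rho_k')}+\delta_{(\rho_k',\rho_k)}),$$ with independent uniform $\zeta_{\{i,j\}}\in[0,1]$ and independent unit rate Poisson processes $\{(\theta_j,\vartheta_j)\}$ and, for each $j$, $\{(\sigma_{jk},\chi_{jk})\}_k$ on $[0,\infty)^2$, and $\{(\rho_k,\rho_k',\eta_k)\}$ on $[0,\infty)^3$. The sequence is sampling convergent to $\mathcal W$ if for every $s\ge 0$ the $s/\sqrt{2e(G_j)}$-samplings of $G_j$ converge in distribution to the unlabeled graph of $\Gamma_s$. **Theorem.** Let $G_1,G_2,\dots$ be a sampling convergent sequence of graphs with $e(G_j)\to\infty$.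 Suppose that the maximal degree of $G_j$ (not counting loops) is $o(\sqrt{e(G_j)})$ or, more generally, that $$\frac{\overline{d^2}(G_j)}{(\overline d(G_j))^2}\sqrt{\rho(G_j)}\to 0 .$$ Then $G_1,G_2,\dots$ is sampling convergent to a graphex of the form $(1/2,0,W)$, where $W(x,y)=0$ for all $x\ne y$. Moreover, the sampled graphs are asymptotically disjoint edges and loops: for every $r\ge0$, the probability that the $r/\sqrt{2e(G_j)}$-sampling of $G_j$ is a vertex-disjoint union of single edges and single loops tends to $1$. -/

import Mathlib

open MeasureTheory ProbabilityTheory Filter Topology Asymptotics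
open scoped NNReal ENNReal

noncomputable section

/-! ### Graphs (no multiple edges, loops allowed) and unlabeled graphs -/

/-- An undirected graph without multiple edges on the vertex set `V`; loops are allowed. -/
structure LoopGraph (V : Type*) where
  Adj : V → V → Prop
  symm : ∀ ⦃x y⦄, Adj x y → Adj y x

namespace LoopGraph

variable {V : Type*}

/-- The set of edges of `G`, loops included, as unordered pairs. -/
def edgeSet (G : LoopGraph V) : Set (Sym2 V) :=
  {z | ∃ x y, z = s(x, y) ∧ G.Adj x y}

/-- `e(G)`: the number of non-loop edges. -/
def numEdges (G : LoopGraph V) : ℕ :=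
  {z ∈ G.edgeSet | ¬ z.IsDiag}.ncard

/-- The degree of a vertex, not counting loops. -/
def degree (G : LoopGraph V) (v : V) : ℕ :=
  {u | u ≠ v ∧ G.Adj v u}.ncard

/-- The maximal degree. -/
def maxDegree [Fintype V] (G : LoopGraph V) : ℕ :=
  Finset.univ.sup G.degree

/-- The average degree. -/
def avgDegree [Fintype V] (G : LoopGraph V) : ℝ :=
  (∑ v, (G.degree v : ℝ)) / Fintype.card V

/-- The average squared degree. -/
def avgSqDegree [Fintype V] (G : LoopGraph V) : ℝ :=
  (∑ v, (G.degree v : ℝ) ^ 2) / Fintype.card V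

/-- The edge density `2 e(G) / v(G) ^ 2`. -/
def edgeDensity [Fintype V] (G : LoopGraph V) : ℝ :=
  2 * (G.numEdges : ℝ) / (Fintype.card V : ℝ) ^ 2

/-- The vertices of the subgraph of `G` induced by `T` that are not isolated in this subgraph
(a vertex with a loop is not isolated). -/
def nonIsolated (G : LoopGraph V) (T : Set V) : Set V :=
  {v | v ∈ T ∧ ∃ u ∈ T, G.Adj v u}

/-- The subgraph of `G` induced by `T`, with its isolated vertices discarded. -/
def restrict (G : LoopGraph V) (T : Set V) : LoopGraph (G.nonIsolated T) where
  Adj x y := G.Adj x y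
  symm _ _ h := G.symm h

/-- The graph obtained by renaming the vertices along a bijection. -/
def relabel {V' : Type*} (G : LoopGraph V) (f : V ≃ V') : LoopGraph V' where
  Adj x y := G.Adj (f.symm x) (f.symm y)
  symm _ _ h := G.symm h

/-- Every vertex has exactly one neighbour, where a vertex with a loop is a neighbour of itself:
the graph is a vertex-disjoint union of single edges and single loops. -/
def IsDisjointEdgesLoops (G : LoopGraph V) : Prop :=
  ∀ v, ∃! u, G.Adj v u

end LoopGraph

/-- Isomorphism of finite graphs. -/
instance finiteGraphSetoid : Setoid (Σ n : ℕ, LoopGraph (Fin n)) where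
  r G H := Nonempty (G.2.Adj ≃r H.2.Adj)
  iseqv := ⟨fun _ => ⟨RelIso.refl _⟩, fun ⟨f⟩ => ⟨f.symm⟩, fun ⟨f⟩ ⟨g⟩ => ⟨f.trans g⟩⟩

/-- Unlabeled finite graphs, i.e. isomorphism classes of finite graphs; a countable set, with the
discrete topology and the discrete sigma-algebra. -/
def UnlabeledGraph : Type := Quotient finiteGraphSetoid

instance : TopologicalSpace UnlabeledGraph := ⊥
instance : DiscreteTopology UnlabeledGraph := ⟨rfl⟩
instance : MeasurableSpace UnlabeledGraph := ⊤
instance : DiscreteMeasurableSpace UnlabeledGraph := ⟨fun _ => trivial⟩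
instance : BorelSpace UnlabeledGraph := ⟨by
  refine le_antisymm (fun s _ => ?_) le_top
  exact MeasurableSpace.measurableSet_generateFrom (isOpen_discrete s)⟩

/-- The isomorphism class of a graph on `Fin n`. -/
def UnlabeledGraph.mk {n : ℕ} (G : LoopGraph (Fin n)) : UnlabeledGraph :=
  Quotient.mk finiteGraphSetoid ⟨n, G⟩

/-- The unlabeled graph is a vertex-disjoint union of single edges and single loops. -/
def UnlabeledGraph.IsDisjointEdgesLoops (H : UnlabeledGraph) : Prop :=
  ∃ (n : ℕ) (G : LoopGraph (Fin n)), UnlabeledGraph.mk G = H ∧ G.IsDisjointEdgesLoops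

open Classical in
/-- The unlabeled graph associated with a finite graph. (Junk value for an infinite graph: the
empty graph.) -/
def LoopGraph.unlabel {V : Type*} (G : LoopGraph V) : UnlabeledGraph :=
  if _h : Finite V then UnlabeledGraph.mk (G.relabel (Finite.equivFin V))
  else UnlabeledGraph.mk (n := 0) ⟨fun _ _ => False, fun _ _ h => h⟩

/-! ### Sampling -/

/-- `min (p, 1)` as an element of the unit interval. -/
def minOne (p : ℝ≥0) : unitInterval :=
  ⟨((min p 1 : ℝ≥0) : ℝ), NNReal.coe_nonneg _, by exact_mod_cast min_le_right p 1⟩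

/-- The law of the `p`-sampling of `G`: include each vertex independently with probability
`min (p, 1)`, take the induced subgraph, discard its isolated vertices and forget the labels. -/
def pSampling {V : Type*} [Fintype V] (G : LoopGraph V) (p : ℝ≥0) :
    ProbabilityMeasure UnlabeledGraph :=
  ⟨(setBernoulli (Set.univ : Set V) (minOne p)).map (fun T => (G.restrict T).unlabel),
    Measure.isProbabilityMeasure_map Measurable.of_discrete.aemeasurable⟩

/-- The canonical sampling distribution: the law of the `r / √(2 e(G))`-sampling of `G`. -/
def samplingDist {V : Type*} [Fintype V] (G : LoopGraph V) (r : ℝ≥0) :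
    ProbabilityMeasure UnlabeledGraph :=
  pSampling G (r / NNReal.sqrt (2 * (G.numEdges : ℝ≥0)))

/-- A sequence of finite graphs is sampling convergent if, for every `r ≥ 0`, the random graphs
obtained by `r / √(2 e(G j))`-sampling converge in distribution. -/
def SamplingConvergent {V : ℕ → Type*} [∀ j, Fintype (V j)] (G : ∀ j, LoopGraph (V j)) : Prop :=
  ∀ r : ℝ≥0, ∃ Q : ProbabilityMeasure UnlabeledGraph,
    Tendsto (fun j => samplingDist (G j) r) atTop (𝓝 Q)

/-! ### Graphexes -/

/-- Lebesgue measure on `[0, ∞)`. -/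
def lebesgue : Measure ℝ≥0 := (volume : Measure ℝ).comap NNReal.toReal

/-- `μ_W (y) = ∫ W(x, y) dx`. -/
def graphonMarginal (W : ℝ≥0 → ℝ≥0 → unitInterval) (y : ℝ≥0) : ℝ≥0∞ :=
  ∫⁻ x, ENNReal.ofReal (W x y) ∂lebesgue

/-- A graphex `(I, S, W)`. -/
structure Graphex where
  I : ℝ≥0
  S : ℝ≥0 → ℝ≥0
  W : ℝ≥0 → ℝ≥0 → unitInterval
  measurable_S : Measurable S
  integrable_min_S : ∫⁻ x, ((min (S x) 1 : ℝ≥0) : ℝ≥0∞) ∂lebesgue < ∞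
  measurable_W : Measurable (Function.uncurry W)
  symm_W : ∀ x y, W x y = W y x
  marginal_finite : lebesgue {x | graphonMarginal W x = ∞} = 0
  marginal_large : lebesgue {x | 1 < graphonMarginal W x} < ∞
  integrable_small :
    ∫⁻ z in {z : ℝ≥0 × ℝ≥0 | graphonMarginal W z.1 ≤ 1 ∧ graphonMarginal W z.2 ≤ 1},
      ENNReal.ofReal (W z.1 z.2) ∂(lebesgue.prod lebesgue) < ∞
  integrable_diag : ∫⁻ x, ENNReal.ofReal (W x x) ∂lebesgue < ∞

/-! ### Unit rate Poisson processes on the orthant `[0, ∞) ^ d`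

The process is built from the partition into unit cubes `k + [0, 1] ^ d`, `k ∈ ℕ ^ d`: independently
for all cubes, a `Poisson(1)` number of points, which are independent and uniform in the cube. -/

/-- The sample space: for each cube the number of its points, and a sequence of relative positions
(of which only as many are used as the number says). -/
abbrev PoissonSpace (d : ℕ) : Type :=
  (Fin d → ℕ) → ℕ × (ℕ → Fin d → unitInterval)

/-- The probability measure on the sample space. -/
def poissonProcess (d : ℕ) : Measure (PoissonSpace d) :=
  Measure.infinitePi fun _ : Fin d → ℕ =>
    (poissonMeasure 1).prod
      (Measure.infinitePi fun _ : ℕ => Measure.pi fun _ : Fin d => (volume : Measure unitInterval))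

instance (d : ℕ) : IsProbabilityMeasure (poissonProcess d) := by
  unfold poissonProcess; infer_instance

/-- Indices of (potential) points: a cube and a number. -/
abbrev PointIndex (d : ℕ) : Type := (Fin d → ℕ) × ℕ

/-- The potential point `i` is indeed a point of the process `ω`. -/
def IsPoint {d : ℕ} (ω : PoissonSpace d) (i : PointIndex d) : Prop :=
  i.2 < (ω i.1).1

/-- The position of the point `i` of the process `ω`. -/
def position {d : ℕ} (ω : PoissonSpace d) (i : PointIndex d) (a : Fin d) : ℝ≥0 :=
  (i.1 a : ℝ≥0) + unitInterval.toNNReal ((ω i.1).2 i.2 a)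

/-! ### The graphex process -/

/-- The randomness of the graphex process: the Poisson process `(θ_j, ϑ_j)`; for each `j` the
Poisson process `(σ_jk, χ_jk)`; the Poisson process `(ρ_k, ρ'_k, η_k)`; the uniform variables
`ζ_{i,j}`, indexed by unordered pairs. -/
abbrev GraphexSpace : Type :=
  PoissonSpace 2 × (PointIndex 2 → PoissonSpace 2) × PoissonSpace 3 ×
    (Sym2 (PointIndex 2) → unitInterval)

/-- All Poisson processes and uniform variables are independent. -/
def graphexProb : Measure GraphexSpace :=
  (poissonProcess 2).prod ((Measure.infinitePi fun _ : PointIndex 2 => poissonProcess 2).prod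
    ((poissonProcess 3).prod
      (Measure.infinitePi fun _ : Sym2 (PointIndex 2) => (volume : Measure unitInterval))))

namespace Graphex

/-- The pairs of labels `(x, y)` which are atoms of the adjacency measure due to the graphon:
`(θ_i, θ_j)` with `ζ_{i,j} ≤ W(ϑ_i, ϑ_j)`. -/
def graphonEdge (𝒲 : Graphex) (ω : GraphexSpace) (x y : ℝ≥0) : Prop :=
  ∃ i j : PointIndex 2, IsPoint ω.1 i ∧ IsPoint ω.1 j ∧
    ω.2.2.2 s(i, j) ≤ 𝒲.W (position ω.1 i 1) (position ω.1 j 1) ∧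
    x = position ω.1 i 0 ∧ y = position ω.1 j 0

/-- The pairs `(θ_j, σ_jk)` with `χ_jk ≤ S(ϑ_j)`. -/
def starEdge (𝒲 : Graphex) (ω : GraphexSpace) (x y : ℝ≥0) : Prop :=
  ∃ j k : PointIndex 2, IsPoint ω.1 j ∧ IsPoint (ω.2.1 j) k ∧
    position (ω.2.1 j) k 1 ≤ 𝒲.S (position ω.1 j 1) ∧
    x = position ω.1 j 0 ∧ y = position (ω.2.1 j) k 0

/-- The pairs `(ρ_k, ρ'_k)` with `η_k ≤ I`. -/
def isolatedEdge (𝒲 : Graphex) (ω : GraphexSpace) (x y : ℝ≥0) : Prop :=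
  ∃ k : PointIndex 3, IsPoint ω.2.2.1 k ∧ position ω.2.2.1 k 2 ≤ 𝒲.I ∧
    x = position ω.2.2.1 k 0 ∧ y = position ω.2.2.1 k 1

/-- The infinite random graph with labels in `[0, ∞)` given by the adjacency measure
`∑_{i,j} 1[ζ_{i,j} ≤ W(ϑ_i, ϑ_j)] δ(θ_i, θ_j)`
`+ ∑_{j,k} 1[χ_jk ≤ S(ϑ_j)] (δ(θ_j, σ_jk) + δ(σ_jk, θ_j))`
`+ ∑_k 1[η_k ≤ I] (δ(ρ_k, ρ'_k) + δ(ρ'_k, ρ_k))`: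
two labels are adjacent if they form an atom of this measure. Labels without an adjacent label
are not considered as vertices; they are discarded by `LoopGraph.restrict` below. -/
def labeledGraph (𝒲 : Graphex) (ω : GraphexSpace) : LoopGraph ℝ≥0 where
  Adj x y := 𝒲.graphonEdge ω x y ∨ (𝒲.starEdge ω x y ∨ 𝒲.starEdge ω y x) ∨
    (𝒲.isolatedEdge ω x y ∨ 𝒲.isolatedEdge ω y x)
  symm := by
    rintro x y (⟨i, j, hi, hj, h, hx, hy⟩ | h | h)
    · exact Or.inl ⟨j, i, hj, hi, by rw [Sym2.eq_swap, 𝒲.symm_W]; exact h, hy, hx⟩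
    · exact Or.inr (Or.inl h.symm)
    · exact Or.inr (Or.inr h.symm)

/-- The unlabeled graph at time `s` of the graphex process: restrict the labeled graph to
labels in `[0, s]` and forget the labels. -/
def unlabeledAt (𝒲 : Graphex) (s : ℝ≥0) (ω : GraphexSpace) : UnlabeledGraph :=
  ((𝒲.labeledGraph ω).restrict (Set.Iic s)).unlabel

/-- The unlabeled graphex process distribution with parameters `𝒲` and `s`. -/
def processDist (𝒲 : Graphex) (s : ℝ≥0) : Measure UnlabeledGraph :=
  graphexProb.map (𝒲.unlabeledAt s)

end Graphex

/-- A sequence of finite graphs is sampling convergent to the graphex `𝒲`: for every `s ≥ 0` the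
canonical sampling distributions converge weakly to the unlabeled graphex process distribution. -/
def SamplingConvergentTo {V : ℕ → Type*} [∀ j, Fintype (V j)] (G : ∀ j, LoopGraph (V j))
    (𝒲 : Graphex) : Prop :=
  ∀ s : ℝ≥0, ∃ Q : ProbabilityMeasure UnlabeledGraph,
    (Q : Measure UnlabeledGraph) = 𝒲.processDist s ∧
    Tendsto (fun j => samplingDist (G j) s) atTop (𝓝 Q)

end

/-!
The degree condition says that `∑ v, d(v) ^ 2 = o(e(G) ^ (3 / 2))`. For the sampling probability
`p = r / √(2 e(G))` this means that the expected number of sampled paths with two edges, which is at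
most `p ^ 3 * ∑ v, d(v) ^ 2`, tends to zero. Sampling convergence controls the loops: if `L` is the
number of loops and `N` the number of sampled ones, then `E[2 ^ (-N)] = (1 - p / 2) ^ L` has a
positive limit, so `L / √(2 e(G))` converges to some `l` (`exists_tendsto_numLoops`). By the
Cauchy-Schwarz inequality, sampled edges at a vertex with a sampled loop then disappear as well
(`tendsto_sumLoopDegree`), so the sampled graph is asymptotically a disjoint union of edges and
loops (`tendsto_samplingDist_disjoint`).

Such a graph is determined by its numbers of edges and of loops
(`UnlabeledGraph.injOn_edgesLoops`), so it remains to find the joint limit law `q` of these two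
numbers. Weighting an event by the number of sampled edges amounts to adding, for each edge, its two
ends to the sample (`card_mul_setBernoulli_real`); as sampled edges do not interact, this adds
exactly one edge, up to an error that tends to zero. In the limit this gives the recursion
`(a + 1) * q (a + 1, b) = (r ^ 2 / 2) * q (a, b)`, and likewise
`(b + 1) * q (a, b + 1) = r * l * q (a, b)` for loops. The only probability measure obeying both is
the product of the Poisson measures with rates `r ^ 2 / 2` and `r * l` (`map_edgesLoops_limit`).

The graphex is `(1/2, 0, W)`, with `W` the indicator function of the diagonal over `[0, l]`. Almost
surely no two positions of its Poisson points coincide, and then its graph at time `s` consists of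
one edge for each point `(ρ, ρ', η)` in `[0, s] × [0, s] × [0, 1/2]` and one loop for each point
`(θ, ϑ)` in `[0, s] × [0, l]`. These numbers are independent Poisson variables with rates
`s ^ 2 / 2` and `s * l` (`processDist_diagGraphex`).
-/

noncomputable section

/-! ### Edges, loops, and disjoint unions of them -/

namespace LoopGraph

variable {V V' : Type*}

/-- The number of loops. -/
def numLoops (G : LoopGraph V) : ℕ :=
  {v | G.Adj v v}.ncard

/-- The number of arcs: ordered pairs of distinct adjacent vertices. -/
def numArcs (G : LoopGraph V) : ℕ :=
  {z : V × V | z.1 ≠ z.2 ∧ G.Adj z.1 z.2}.ncard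

/-- The simple graph obtained by removing all loops. -/
def toSimpleGraph (G : LoopGraph V) : SimpleGraph V where
  Adj x y := x ≠ y ∧ G.Adj x y
  symm := ⟨fun _ _ h => ⟨h.1.symm, G.symm h.2⟩⟩
  loopless := ⟨fun _ h => h.1 rfl⟩

lemma toSimpleGraph_adj (G : LoopGraph V) {x y : V} :
    G.toSimpleGraph.Adj x y ↔ x ≠ y ∧ G.Adj x y := Iff.rfl

lemma sum_degree_eq_numArcs [Fintype V] (G : LoopGraph V) :
    ∑ v, G.degree v = G.numArcs := by
  classical
  have h : {z : V × V | z.1 ≠ z.2 ∧ G.Adj z.1 z.2} =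
      ↑((Finset.univ : Finset V).biUnion fun v =>
        (Finset.univ.filter fun u => u ≠ v ∧ G.Adj v u).image fun u => (v, u)) := by
    ext ⟨x, y⟩
    simp [eq_comm]
  rw [numArcs, h, Set.ncard_coe_finset, Finset.card_biUnion]
  · refine Finset.sum_congr rfl fun v _ => ?_
    rw [Finset.card_image_of_injective _ (fun _ _ h => (Prod.mk.inj h).2), degree,
      ← Set.ncard_coe_finset]
    simp
  · intro x _ y _ hxy
    simp only [Function.onFun, Finset.disjoint_left, Finset.mem_image]
    rintro _ ⟨u, _, rfl⟩ ⟨w, _, h⟩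
    exact hxy (Prod.mk.inj h).1.symm

lemma sum_degree_eq_two_mul_numEdges [Fintype V] (G : LoopGraph V) :
    ∑ v, G.degree v = 2 * G.numEdges := by
  classical
  have h := G.toSimpleGraph.sum_degrees_eq_twice_card_edges
  have h2 : G.toSimpleGraph.edgeFinset.card = G.numEdges := by
    rw [numEdges, ← Set.ncard_coe_finset]
    congr 1
    ext z
    induction z with
    | _ x y =>
      simp only [SimpleGraph.coe_edgeFinset, SimpleGraph.mem_edgeSet, toSimpleGraph_adj, edgeSet,
        Set.mem_ofPred_eq, Sym2.mk_isDiag_iff]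
      constructor
      · rintro ⟨h1, h2⟩
        exact ⟨⟨x, y, rfl, h2⟩, h1⟩
      · rintro ⟨⟨a, b, hab, h⟩, h1⟩
        refine ⟨h1, ?_⟩
        rcases Sym2.eq_iff.1 hab with ⟨rfl, rfl⟩ | ⟨rfl, rfl⟩
        exacts [h, G.symm h]
  rw [← h2, ← h]
  refine Finset.sum_congr rfl fun v _ => ?_
  rw [degree, ← SimpleGraph.card_neighborFinset_eq_degree, ← Set.ncard_coe_finset]
  congr 1
  ext u
  simp [toSimpleGraph_adj, eq_comm]

lemma numArcs_eq_two_mul_numEdges [Finite V] (G : LoopGraph V) :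
    G.numArcs = 2 * G.numEdges := by
  have := Fintype.ofFinite V
  rw [← sum_degree_eq_numArcs, sum_degree_eq_two_mul_numEdges]

lemma numArcs_congr {G : LoopGraph V} {H : LoopGraph V'} (f : G.Adj ≃r H.Adj) :
    G.numArcs = H.numArcs := by
  rw [numArcs, numArcs, ← Set.ncard_image_of_injective _
    (f.toEquiv.prodCongr f.toEquiv).injective]
  congr 1
  ext ⟨x, y⟩
  obtain ⟨x, rfl⟩ := f.surjective x
  obtain ⟨y, rfl⟩ := f.surjective y
  simp [f.map_rel_iff]

lemma numLoops_congr {G : LoopGraph V} {H : LoopGraph V'} (f : G.Adj ≃r H.Adj) :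
    G.numLoops = H.numLoops := by
  rw [numLoops, numLoops, ← Set.ncard_image_of_injective _ f.injective]
  congr 1
  ext x
  obtain ⟨x, rfl⟩ := f.surjective x
  simp [f.map_rel_iff]

lemma numEdges_congr [Finite V] [Finite V'] {G : LoopGraph V} {H : LoopGraph V'}
    (f : G.Adj ≃r H.Adj) : G.numEdges = H.numEdges := by
  have := numArcs_congr f
  rw [numArcs_eq_two_mul_numEdges, numArcs_eq_two_mul_numEdges] at this
  omega

lemma IsDisjointEdgesLoops.congr {G : LoopGraph V} {H : LoopGraph V'} (f : G.Adj ≃r H.Adj)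
    (h : G.IsDisjointEdgesLoops) : H.IsDisjointEdgesLoops := by
  intro x
  obtain ⟨x, rfl⟩ := f.surjective x
  obtain ⟨y, hy, hu⟩ := h x
  refine ⟨f y, f.map_rel_iff.2 hy, fun z hz => ?_⟩
  obtain ⟨z, rfl⟩ := f.surjective z
  exact congrArg f (hu z (f.map_rel_iff.1 hz))

/-- The graph and its relabelling along a bijection are isomorphic. -/
def relabelIso (G : LoopGraph V) (f : V ≃ V') : G.Adj ≃r (G.relabel f).Adj where
  toEquiv := f
  map_rel_iff' := by simp [relabel]

/-- In a disjoint union of edges and loops, sending each vertex to its only neighbour is an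
involution; its graph is the adjacency relation. -/
lemma IsDisjointEdgesLoops.exists_perm {G : LoopGraph V} (h : G.IsDisjointEdgesLoops) :
    ∃ σ : Equiv.Perm V, σ ^ 2 = 1 ∧ ∀ x y, G.Adj x y ↔ y = σ x := by
  choose f hf hu using h
  have hinv : Function.Involutive f := fun x => (hu (f x) x (G.symm (hf x))).symm
  refine ⟨hinv.toPerm f, ?_, fun x y => ⟨fun h => hu x y h, ?_⟩⟩
  · ext x
    simp [pow_two, hinv x]
  · rintro rfl
    exact hf x

/-- For an involution `σ` encoding a disjoint union of edges and loops, the moved points are the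
ends of the edges and the fixed points are the loops. -/
lemma card_support_eq_numArcs {n : ℕ} {G : LoopGraph (Fin n)} {σ : Equiv.Perm (Fin n)}
    (hσ : ∀ x y, G.Adj x y ↔ y = σ x) : σ.support.card = G.numArcs := by
  have h : {z : Fin n × Fin n | z.1 ≠ z.2 ∧ G.Adj z.1 z.2} =
      (fun x => (x, σ x)) '' (σ.support : Set (Fin n)) := by
    ext ⟨x, y⟩
    simp only [hσ, Set.mem_ofPred_eq, Set.mem_image, Finset.mem_coe, Equiv.Perm.mem_support,
      Prod.mk.injEq]
    constructor
    · rintro ⟨h, rfl⟩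
      exact ⟨x, h.symm, rfl, rfl⟩
    · rintro ⟨x, h, rfl, rfl⟩
      exact ⟨h.symm, rfl⟩
  rw [numArcs, h, Set.ncard_image_of_injective _ (fun _ _ h => (Prod.mk.inj h).1),
    Set.ncard_coe_finset]

lemma card_support_add_numLoops {n : ℕ} {G : LoopGraph (Fin n)} {σ : Equiv.Perm (Fin n)}
    (hσ : ∀ x y, G.Adj x y ↔ y = σ x) : σ.support.card + G.numLoops = n := by
  have h : {v | G.Adj v v} = ((σ.supportᶜ : Finset (Fin n)) : Set (Fin n)) := by
    ext x
    simp [hσ, eq_comm]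
  rw [numLoops, h, Set.ncard_coe_finset, Finset.card_add_card_compl, Fintype.card_fin]

/-- Two involutions with the same numbers of fixed and of moved points are conjugate, so that
disjoint unions of edges and loops are classified by the numbers of edges and of loops. -/
lemma IsDisjointEdgesLoops.nonempty_iso {n n' : ℕ} {G : LoopGraph (Fin n)}
    {H : LoopGraph (Fin n')} (hG : G.IsDisjointEdgesLoops) (hH : H.IsDisjointEdgesLoops)
    (he : G.numEdges = H.numEdges) (hl : G.numLoops = H.numLoops) :
    Nonempty (G.Adj ≃r H.Adj) := by
  obtain ⟨σ, hσ, hσG⟩ := hG.exists_perm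
  obtain ⟨τ, hτ, hτH⟩ := hH.exists_perm
  have hs : σ.support.card = τ.support.card := by
    rw [card_support_eq_numArcs hσG, card_support_eq_numArcs hτH, numArcs_eq_two_mul_numEdges,
      numArcs_eq_two_mul_numEdges, he]
  obtain rfl : n = n' := by
    rw [← card_support_add_numLoops hσG, ← card_support_add_numLoops hτH, hs, hl]
  have : Fact (Nat.Prime 2) := ⟨Nat.prime_two⟩
  have hc : σ.cycleType = τ.cycleType := by
    have h1 := Equiv.Perm.cycleType_of_pow_prime_eq_one hσ
    have h2 := Equiv.Perm.cycleType_of_pow_prime_eq_one hτ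
    have h3 := σ.sum_cycleType
    have h4 := τ.sum_cycleType
    rw [h1, Multiset.sum_replicate, smul_eq_mul] at h3
    rw [h2, Multiset.sum_replicate, smul_eq_mul] at h4
    rw [h1, h2]
    congr 1
    omega
  obtain ⟨c, hc⟩ := isConj_iff.1 (Equiv.Perm.isConj_iff_cycleType_eq.2 hc)
  refine ⟨⟨c, fun {x y} => ?_⟩⟩
  rw [hτH, hσG, ← hc]
  simp

/-! ### Restricted graphs -/

lemma numArcs_restrict (G : LoopGraph V) (T : Set V) :
    (G.restrict T).numArcs =
      {z : V × V | z.1 ≠ z.2 ∧ G.Adj z.1 z.2 ∧ z.1 ∈ T ∧ z.2 ∈ T}.ncard := by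
  rw [numArcs, ← Set.ncard_image_of_injective _
    (Subtype.val_injective.prodMap Subtype.val_injective)]
  congr 1
  ext ⟨x, y⟩
  simp only [Set.mem_image, Set.mem_ofPred_eq, Prod.exists, Prod.map_apply, Prod.mk.injEq,
    restrict, nonIsolated, Subtype.exists]
  constructor
  · rintro ⟨a, ha, b, hb, ⟨h, h'⟩, rfl, rfl⟩
    exact ⟨fun e => h (Subtype.ext e), h', ha.1, hb.1⟩
  · rintro ⟨h, h', hx, hy⟩
    exact ⟨x, ⟨hx, y, hy, h'⟩, y, ⟨hy, x, hx, G.symm h'⟩,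
      ⟨fun e => h (congrArg Subtype.val e), h'⟩, rfl, rfl⟩

lemma numLoops_restrict (G : LoopGraph V) (T : Set V) :
    (G.restrict T).numLoops = {v | G.Adj v v ∧ v ∈ T}.ncard := by
  rw [numLoops, ← Set.ncard_image_of_injective _ Subtype.val_injective]
  congr 1
  ext x
  simp only [Set.mem_image, Set.mem_ofPred_eq, restrict, nonIsolated, Subtype.exists]
  constructor
  · rintro ⟨a, ha, h, rfl⟩
    exact ⟨h, ha.1⟩
  · rintro ⟨h, hx⟩
    exact ⟨x, ⟨hx, x, hx, h⟩, h, rfl⟩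

lemma isDisjointEdgesLoops_restrict {G : LoopGraph V} {T : Set V}
    (h : ∀ v ∈ T, ∀ u ∈ T, ∀ w ∈ T, G.Adj v u → G.Adj v w → u = w) :
    (G.restrict T).IsDisjointEdgesLoops := by
  rintro ⟨v, hv, u, hu, hvu⟩
  refine ⟨⟨u, hu, v, hv, G.symm hvu⟩, hvu, ?_⟩
  rintro ⟨w, hw, _⟩ hvw
  exact Subtype.ext (h v hv w hw u hu hvw hvu)

end LoopGraph

/-! ### Invariants of unlabeled graphs -/

namespace UnlabeledGraph

/-- The numbers of edges and of loops of an unlabeled graph. -/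
def edgesLoops : UnlabeledGraph → ℕ × ℕ :=
  Quotient.lift (fun G => (G.2.numEdges, G.2.numLoops)) fun _ _ ⟨f⟩ =>
    Prod.ext (LoopGraph.numEdges_congr f) (LoopGraph.numLoops_congr f)

lemma edgesLoops_mk {n : ℕ} (G : LoopGraph (Fin n)) :
    (mk G).edgesLoops = (G.numEdges, G.numLoops) := rfl

lemma edgesLoops_unlabel {V : Type*} [Finite V] (G : LoopGraph V) :
    G.unlabel.edgesLoops = (G.numEdges, G.numLoops) := by
  rw [LoopGraph.unlabel, dif_pos ‹_›, edgesLoops_mk,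
    ← LoopGraph.numEdges_congr (G.relabelIso _), ← LoopGraph.numLoops_congr (G.relabelIso _)]

lemma isDisjointEdgesLoops_unlabel {V : Type*} [Finite V] {G : LoopGraph V}
    (h : G.IsDisjointEdgesLoops) : G.unlabel.IsDisjointEdgesLoops := by
  rw [LoopGraph.unlabel, dif_pos ‹_›]
  exact ⟨_, _, rfl, h.congr (G.relabelIso _)⟩

lemma injOn_edgesLoops : Set.InjOn edgesLoops {H | H.IsDisjointEdgesLoops} := by
  rintro _ ⟨n, G, rfl, hG⟩ _ ⟨n', G', rfl, hG'⟩ h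
  rw [edgesLoops_mk, edgesLoops_mk, Prod.mk.injEq] at h
  exact Quotient.sound (hG.nonempty_iso hG' h.1 h.2)

instance : Inhabited UnlabeledGraph :=
  ⟨mk (n := 0) ⟨fun _ _ => False, fun _ _ h => h⟩⟩

/-- The disjoint union of `p.1` edges and `p.2` loops, as the inverse of `edgesLoops` on disjoint
unions of edges and loops. -/
def ofEdgesLoops : ℕ × ℕ → UnlabeledGraph :=
  Function.invFunOn edgesLoops {H | H.IsDisjointEdgesLoops}

lemma ofEdgesLoops_edgesLoops {H : UnlabeledGraph} (h : H.IsDisjointEdgesLoops) :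
    ofEdgesLoops H.edgesLoops = H :=
  injOn_edgesLoops.leftInvOn_invFunOn h

end UnlabeledGraph

/-! ### Random subsets of a finite set -/

lemma abs_measureReal_sub_le {α : Type*} [MeasurableSpace α] (μ : Measure α) [IsFiniteMeasure μ]
    (A B C : α → Prop) (h : ∀ T, ¬ C T → (A T ↔ B T)) :
    |μ.real {T | A T} - μ.real {T | B T}| ≤ μ.real {T | C T} := by
  have h1 : μ.real {T | A T} ≤ μ.real {T | B T} + μ.real {T | C T} := by
    refine (measureReal_mono fun T hT => ?_).trans (measureReal_union_le _ _)
    by_cases hC : C T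
    exacts [Or.inr hC, Or.inl ((h T hC).1 hT)]
  have h2 : μ.real {T | B T} ≤ μ.real {T | A T} + μ.real {T | C T} := by
    refine (measureReal_mono fun T hT => ?_).trans (measureReal_union_le _ _)
    by_cases hC : C T
    exacts [Or.inr hC, Or.inl ((h T hC).2 hT)]
  rw [abs_le]
  constructor <;> linarith

section RandomSubset

open scoped Classical

variable {V : Type*} [Fintype V] (p : unitInterval)

lemma integral_setBernoulli (g : Set V → ℝ) :
    ∫ T, g T ∂setBernoulli Set.univ p = ∑ T : Set V, (setBernoulli Set.univ p).real {T} * g T := by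
  rw [integral_fintype .of_finite]
  rfl

lemma setBernoulli_real_insert {v : V} {T : Set V} (hv : v ∉ T) :
    (p : ℝ) * (setBernoulli Set.univ p).real {T} =
      (1 - p) * (setBernoulli Set.univ p).real {insert v T} := by
  rw [setBernoulli_real_singleton _ (Set.subset_univ _) Set.finite_univ,
    setBernoulli_real_singleton _ (Set.subset_univ _) Set.finite_univ,
    Set.ncard_insert_of_notMem hv]
  have h : Set.univ \ T = insert v (Set.univ \ insert v T) := by
    ext x
    by_cases hx : x = v <;> simp [hx, hv]
  rw [h, Set.ncard_insert_of_notMem (by simp)]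
  ring

/-- Conditioning a random subset on containing `v` amounts to inserting `v`. -/
lemma integral_setBernoulli_mem (v : V) (g : Set V → ℝ) :
    ∫ T, (if v ∈ T then g T else 0) ∂setBernoulli Set.univ p =
      p * ∫ T, g (insert v T) ∂setBernoulli Set.univ p := by
  rw [integral_setBernoulli, integral_setBernoulli]
  set w : Set V → ℝ := fun T => (setBernoulli Set.univ p).real {T} with hw
  have h1 : ∑ T : Set V, w T * (if v ∈ T then g T else 0) =
      ∑ T : Set V with v ∈ T, w T * g T := by
    simp [Finset.sum_filter]
  -- Removing `v` from a set containing it changes its weight by the factor `(1 - p) / p`.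
  have h2 : ∑ T : Set V with v ∉ T, p * (w T * g (insert v T)) =
      ∑ T : Set V with v ∈ T, (1 - p) * (w T * g T) := by
    refine Finset.sum_nbij' (insert v) (· \ {v}) ?_ ?_ ?_ ?_ ?_
    · intro T _
      simp
    · intro T _
      simp
    · intro T hT
      simp only [Finset.mem_filter, Finset.mem_univ, true_and] at hT
      simp [hT]
    · intro T hT
      simp only [Finset.mem_filter, Finset.mem_univ, true_and] at hT
      simp [hT]
    · intro T hT
      simp only [Finset.mem_filter, Finset.mem_univ, true_and] at hT
      rw [← mul_assoc, ← mul_assoc, hw]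
      simp only
      rw [setBernoulli_real_insert p hT]
  have h3 : ∑ T : Set V with v ∈ T, p * (w T * g (insert v T)) =
      ∑ T : Set V with v ∈ T, p * (w T * g T) := by
    refine Finset.sum_congr rfl fun T hT => ?_
    rw [Set.insert_eq_of_mem (Finset.mem_filter.1 hT).2]
  change ∑ T : Set V, w T * (if v ∈ T then g T else 0) = p * ∑ T : Set V, w T * g (insert v T)
  rw [h1, Finset.mul_sum,
    ← Finset.sum_filter_add_sum_filter_not Finset.univ (fun T : Set V => v ∈ T), h2, h3,
    ← Finset.mul_sum, ← Finset.mul_sum]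
  ring

lemma integral_setBernoulli_subset (e : Finset V) (g : Set V → ℝ) :
    ∫ T, (if (e : Set V) ⊆ T then g T else 0) ∂setBernoulli Set.univ p =
      p ^ e.card * ∫ T, g (T ∪ e) ∂setBernoulli Set.univ p := by
  induction e using Finset.induction_on generalizing g with
  | empty => simp
  | insert v e hv ih =>
    have h : ∀ T : Set V, (if ((insert v e : Finset V) : Set V) ⊆ T then g T else 0) =
        if v ∈ T then (if (e : Set V) ⊆ T then g T else 0) else 0 := by
      intro T
      by_cases h1 : v ∈ T <;> by_cases h2 : (e : Set V) ⊆ T <;>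
        simp [Set.insert_subset_iff, h1, h2]
    have h' : ∀ T : Set V, (if (e : Set V) ⊆ insert v T then g (insert v T) else 0) =
        if (e : Set V) ⊆ T then g (insert v T) else 0 := by
      intro T
      rw [Set.subset_insert_iff_of_notMem (by simpa using hv)]
    simp_rw [h]
    rw [integral_setBernoulli_mem]
    simp_rw [h']
    rw [ih, Finset.card_insert_of_notMem hv, pow_succ]
    simp only [Finset.coe_insert, Set.union_insert]
    ring

lemma integral_ite_setBernoulli (P : Set V → Prop) :
    ∫ T, (if P T then (1 : ℝ) else 0) ∂setBernoulli Set.univ p =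
      (setBernoulli Set.univ p).real {T | P T} := by
  rw [← integral_indicator_one (Set.Finite.measurableSet (Set.toFinite _))]
  rfl

lemma setBernoulli_real_subset (e : Finset V) :
    (setBernoulli Set.univ p).real {T | (e : Set V) ⊆ T} = p ^ e.card := by
  rw [← integral_ite_setBernoulli, integral_setBernoulli_subset p e (fun _ => 1)]
  simp

lemma setBernoulli_real_mem (v : V) :
    (setBernoulli Set.univ p).real {T | v ∈ T} = p := by
  simpa using setBernoulli_real_subset p {v}

/-- The size-biasing identity behind the Poisson recursions: if `N T` counts the members of a
family of finite sets `e i` contained in `T`, then weighting an event by `N` amounts to inserting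
each of the sets `e i` in turn. -/
lemma card_mul_setBernoulli_real {ι : Type*} (s : Finset ι) (e : ι → Finset V) (k : ℕ)
    (A : Set V → Prop) (hA : ∀ T, A T → (s.filter fun i => (e i : Set V) ⊆ T).card = k) :
    k * (setBernoulli Set.univ p).real {T | A T} =
      ∑ i ∈ s, (p : ℝ) ^ (e i).card * (setBernoulli Set.univ p).real {T | A (T ∪ e i)} := by
  rw [← integral_ite_setBernoulli, ← integral_const_mul]
  have h : ∀ T : Set V, (k : ℝ) * (if A T then 1 else 0) =
      ∑ i ∈ s, if (e i : Set V) ⊆ T then (if A T then 1 else 0) else 0 := by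
    intro T
    by_cases hT : A T
    · rw [← hA T hT]
      simp [hT]
    · simp [hT]
  simp_rw [h]
  rw [integral_finsetSum _ fun _ _ => .of_finite]
  refine Finset.sum_congr rfl fun i _ => ?_
  rw [integral_setBernoulli_subset p (e i) (fun T => if A T then 1 else 0),
    integral_ite_setBernoulli]

/-- The probability generating function of the number of sampled elements of `s`. -/
lemma integral_pow_card_setBernoulli (s : Finset V) (a : ℝ) :
    ∫ T, a ^ (s.filter (· ∈ T)).card ∂setBernoulli Set.univ p = (1 - p * (1 - a)) ^ s.card := by
  induction s using Finset.induction_on with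
  | empty => simp
  | insert v s hv ih =>
    have h : ∀ T : Set V, a ^ ((insert v s).filter (· ∈ T)).card =
        a ^ (s.filter (· ∈ T)).card +
          (a - 1) * if v ∈ T then a ^ (s.filter (· ∈ T)).card else 0 := by
      intro T
      by_cases hT : v ∈ T
      · rw [Finset.filter_insert, if_pos hT, Finset.card_insert_of_notMem (by simp [hv]),
          if_pos hT]
        ring
      · rw [Finset.filter_insert, if_neg hT, if_neg hT]
        ring
    have h' : ∀ (T : Set V) [DecidablePred (· ∈ insert v T)],
        s.filter (· ∈ insert v T) = s.filter (· ∈ T) := by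
      intro T _
      refine Finset.filter_congr fun x hx => ?_
      have : x ≠ v := fun e => hv (e ▸ hx)
      simp [this]
    simp_rw [h]
    rw [integral_add .of_finite .of_finite, integral_const_mul, integral_setBernoulli_mem]
    simp_rw [h']
    rw [ih, Finset.card_insert_of_notMem hv]
    ring

lemma setBernoulli_real_exists_subset_le {ι : Type*} (s : Finset ι) (e : ι → Finset V) :
    (setBernoulli Set.univ p).real {T | ∃ i ∈ s, (e i : Set V) ⊆ T} ≤
      ∑ i ∈ s, (p : ℝ) ^ (e i).card := by
  have h : {T : Set V | ∃ i ∈ s, (e i : Set V) ⊆ T} = ⋃ i ∈ s, {T | (e i : Set V) ⊆ T} := by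
    ext T
    simp
  rw [h]
  refine (measureReal_biUnion_finset_le _ _).trans_eq ?_
  exact Finset.sum_congr rfl fun i _ => setBernoulli_real_subset p (e i)

lemma setBernoulli_real_exists_mem_le (s : Finset V) :
    (setBernoulli Set.univ p).real {T | ∃ i ∈ s, i ∈ T} ≤ p * s.card := by
  refine (le_of_eq ?_).trans ((setBernoulli_real_exists_subset_le p s (fun i => {i})).trans_eq ?_)
  · simp
  · simp [mul_comm]

end RandomSubset

/-! ### Edges and loops in a random induced subgraph -/

namespace LoopGraph

open scoped Classical

variable {V : Type*} [Fintype V] (G : LoopGraph V)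

/-- The arcs of a finite graph. -/
def arcs : Finset (V × V) :=
  Finset.univ.filter fun z => z.1 ≠ z.2 ∧ G.Adj z.1 z.2

/-- The vertices with a loop. -/
def loops : Finset V :=
  Finset.univ.filter fun v => G.Adj v v

/-- The neighbours of `v` other than `v` itself. -/
def nbrs (v : V) : Finset V :=
  Finset.univ.filter fun u => u ≠ v ∧ G.Adj v u

/-- The number of arcs inside `T`. -/
def arcsIn (T : Set V) : ℕ :=
  (G.arcs.filter fun z => (({z.1, z.2} : Finset V) : Set V) ⊆ T).card

/-- The number of loops inside `T`. -/
def loopsIn (T : Set V) : ℕ :=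
  (G.loops.filter fun v => (({v} : Finset V) : Set V) ⊆ T).card

/-- The sum of the squared degrees. -/
def sumSqDegree : ℝ := ∑ v, (G.degree v : ℝ) ^ 2

/-- The sum of the degrees of the vertices with a loop. -/
def sumLoopDegree : ℝ := ∑ v ∈ G.loops, (G.degree v : ℝ)

variable {G}

lemma mem_arcs {u v : V} : (u, v) ∈ G.arcs ↔ u ≠ v ∧ G.Adj u v := by simp [arcs]

lemma mem_loops {v : V} : v ∈ G.loops ↔ G.Adj v v := by simp [loops]

lemma mem_nbrs {u v : V} : u ∈ G.nbrs v ↔ u ≠ v ∧ G.Adj v u := by simp [nbrs]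

variable (G)

lemma card_nbrs (v : V) : (G.nbrs v).card = G.degree v := by
  rw [degree, ← Set.ncard_coe_finset]
  simp [nbrs]

lemma card_arcs : G.arcs.card = 2 * G.numEdges := by
  rw [← numArcs_eq_two_mul_numEdges, numArcs, ← Set.ncard_coe_finset]
  simp [arcs]

lemma card_loops : G.loops.card = G.numLoops := by
  rw [numLoops, ← Set.ncard_coe_finset]
  simp [loops]

lemma arcsIn_eq (T : Set V) : G.arcsIn T = 2 * (G.restrict T).numEdges := by
  rw [← numArcs_eq_two_mul_numEdges, numArcs_restrict, arcsIn, ← Set.ncard_coe_finset]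
  congr 1
  ext ⟨x, y⟩
  simp [arcs, Set.insert_subset_iff, and_assoc]

lemma loopsIn_eq (T : Set V) : G.loopsIn T = (G.restrict T).numLoops := by
  rw [numLoops_restrict, loopsIn, ← Set.ncard_coe_finset]
  congr 1
  ext x
  simp [loops]

lemma edgesLoops_restrict_eq_iff (T : Set V) (a b : ℕ) :
    (G.restrict T).unlabel.edgesLoops = (a, b) ↔ G.arcsIn T = 2 * a ∧ G.loopsIn T = b := by
  rw [UnlabeledGraph.edgesLoops_unlabel, Prod.mk.injEq, arcsIn_eq, loopsIn_eq]
  omega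

lemma sum_arcs_fst (f : V → ℝ) : ∑ z ∈ G.arcs, f z.1 = ∑ v, G.degree v * f v := by
  rw [arcs, Finset.sum_filter, Fintype.sum_prod_type]
  refine Finset.sum_congr rfl fun v _ => ?_
  simp only
  rw [← Finset.sum_filter, Finset.sum_const, nsmul_eq_mul, ← card_nbrs, nbrs]
  simp only [ne_comm]

lemma sum_arcs_snd (f : V → ℝ) : ∑ z ∈ G.arcs, f z.2 = ∑ v, G.degree v * f v := by
  rw [← sum_arcs_fst]
  refine Finset.sum_nbij' Prod.swap Prod.swap ?_ ?_ ?_ ?_ ?_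
  · rintro ⟨u, v⟩ h
    exact mem_arcs.2 ⟨(mem_arcs.1 h).1.symm, G.symm (mem_arcs.1 h).2⟩
  · rintro ⟨u, v⟩ h
    exact mem_arcs.2 ⟨(mem_arcs.1 h).1.symm, G.symm (mem_arcs.1 h).2⟩
  all_goals simp

variable {G}

/-- Adding an arc to a vertex set avoiding all neighbours of its ends adds only this arc and its
reverse. -/
lemma arcsIn_union_pair {u v : V} (h : (u, v) ∈ G.arcs) {T : Set V}
    (hT : ∀ w ∈ G.nbrs u ∪ G.nbrs v, w ∉ T) :
    G.arcsIn (T ∪ ({u, v} : Finset V)) = G.arcsIn T + 2 := by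
  obtain ⟨huv, hadj⟩ := mem_arcs.1 h
  have hN : ∀ w ∈ T, ¬ (w ≠ u ∧ G.Adj u w) ∧ ¬ (w ≠ v ∧ G.Adj v w) := fun w hw =>
    ⟨fun h => hT w (by simp [mem_nbrs, h.1, h.2]) hw,
      fun h => hT w (by simp [mem_nbrs, h.1, h.2]) hw⟩
  have hu : u ∉ T := fun hu => (hN u hu).2 ⟨huv, G.symm hadj⟩
  have hv : v ∉ T := fun hv => (hN v hv).1 ⟨huv.symm, hadj⟩
  have h2 : (({(u, v), (v, u)} : Finset (V × V))).card = 2 := by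
    rw [Finset.card_pair]
    simp [huv]
  rw [arcsIn, arcsIn, ← h2, ← Finset.card_union_of_disjoint]
  · congr 1
    ext ⟨x, y⟩
    simp only [Finset.mem_filter, Finset.mem_union, Finset.mem_insert, Finset.mem_singleton,
      Finset.coe_insert, Finset.coe_singleton, Set.insert_subset_iff, Set.singleton_subset_iff,
      Set.mem_union, Set.mem_insert_iff, Set.mem_singleton_iff, mem_arcs, Prod.mk.injEq]
    constructor
    · rintro ⟨⟨hxy, hA⟩, hx, hy⟩
      rcases hx with hx | rfl | rfl <;> rcases hy with hy | rfl | rfl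
      · exact Or.inl ⟨⟨hxy, hA⟩, hx, hy⟩
      · exact absurd ⟨hxy, G.symm hA⟩ (hN x hx).1
      · exact absurd ⟨hxy, G.symm hA⟩ (hN x hx).2
      · exact absurd ⟨hxy.symm, hA⟩ (hN y hy).1
      · exact absurd rfl hxy
      · simp
      · exact absurd ⟨hxy.symm, hA⟩ (hN y hy).2
      · simp
      · exact absurd rfl hxy
    · rintro (⟨⟨hxy, hA⟩, hx, hy⟩ | ⟨rfl, rfl⟩ | ⟨rfl, rfl⟩)
      · exact ⟨⟨hxy, hA⟩, Or.inl hx, Or.inl hy⟩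
      · exact ⟨⟨huv, hadj⟩, by simp, by simp⟩
      · exact ⟨⟨huv.symm, G.symm hadj⟩, by simp, by simp⟩
  · rw [Finset.disjoint_left]
    rintro ⟨x, y⟩ h1 h2
    simp only [Finset.mem_filter, Finset.mem_insert, Finset.mem_singleton,
      Finset.coe_insert, Finset.coe_singleton, Set.insert_subset_iff, Set.singleton_subset_iff,
      Prod.mk.injEq] at h1 h2
    rcases h2 with ⟨rfl, rfl⟩ | ⟨rfl, rfl⟩
    exacts [hu h1.2.1, hv h1.2.1]

lemma loopsIn_union_pair {u v : V} (hu : u ∉ G.loops) (hv : v ∉ G.loops) (T : Set V) :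
    G.loopsIn (T ∪ ({u, v} : Finset V)) = G.loopsIn T := by
  rw [loopsIn, loopsIn]
  congr 1
  refine Finset.filter_congr fun x hx => ?_
  have h1 : x ≠ u := fun e => hu (e ▸ hx)
  have h2 : x ≠ v := fun e => hv (e ▸ hx)
  simp [h1, h2]

lemma arcsIn_union_singleton {v : V} {T : Set V} (hT : ∀ w ∈ G.nbrs v, w ∉ T) :
    G.arcsIn (T ∪ ({v} : Finset V)) = G.arcsIn T := by
  have hN : ∀ w ∈ T, ¬ (w ≠ v ∧ G.Adj v w) := fun w hw h =>
    hT w (by simp [mem_nbrs, h.1, h.2]) hw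
  rw [arcsIn, arcsIn]
  congr 1
  refine Finset.filter_congr ?_
  rintro ⟨x, y⟩ hx
  obtain ⟨hxy, hA⟩ := mem_arcs.1 hx
  simp only [Finset.coe_insert, Finset.coe_singleton, Set.insert_subset_iff,
    Set.singleton_subset_iff, Set.mem_union, Set.mem_singleton_iff]
  constructor
  · rintro ⟨hx | rfl, hy | rfl⟩
    · exact ⟨hx, hy⟩
    · exact absurd ⟨hxy, G.symm hA⟩ (hN x hx)
    · exact absurd ⟨hxy.symm, hA⟩ (hN y hy)
    · exact absurd rfl hxy
  · exact fun h => ⟨Or.inl h.1, Or.inl h.2⟩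

lemma loopsIn_union_singleton {v : V} (hv : v ∈ G.loops) {T : Set V} (hT : v ∉ T) :
    G.loopsIn (T ∪ ({v} : Finset V)) = G.loopsIn T + 1 := by
  rw [loopsIn, loopsIn, ← Finset.card_insert_of_notMem (a := v) (by simp [hT])]
  congr 1
  ext x
  by_cases hx : x = v
  · simp [hx, hv]
  · simp [hx]

variable (G) (p : unitInterval)

-- The law of the set of sampled vertices.
local notation "𝐁" => setBernoulli (Set.univ : Set V) p

/-- The Poisson recursion in the number of edges. The error bounds the probability that an edge,
when added to the sample, interacts with the other sampled vertices. -/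
lemma abs_arcs_recursion_le (a b : ℕ) :
    |((2 * (a + 1) : ℕ) : ℝ) * 𝐁.real {T | G.arcsIn T = 2 * (a + 1) ∧ G.loopsIn T = b} -
      (p : ℝ) ^ 2 * (2 * G.numEdges) * 𝐁.real {T | G.arcsIn T = 2 * a ∧ G.loopsIn T = b}| ≤
    2 * ((p : ℝ) ^ 3 * G.sumSqDegree + (p : ℝ) ^ 2 * G.sumLoopDegree) := by
  rw [card_mul_setBernoulli_real p G.arcs (fun z => {z.1, z.2}) (2 * (a + 1))
    (fun T => G.arcsIn T = 2 * (a + 1) ∧ G.loopsIn T = b) (fun T hT => hT.1)]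
  have hcard : ∀ z ∈ G.arcs, ({z.1, z.2} : Finset V).card = 2 := fun z hz =>
    Finset.card_pair (mem_arcs.1 hz).1
  have hp0 : (0 : ℝ) ≤ p := p.2.1
  set P := 𝐁.real {T | G.arcsIn T = 2 * a ∧ G.loopsIn T = b} with hP
  have h1 : (p : ℝ) ^ 2 * (2 * G.numEdges) * P = ∑ z ∈ G.arcs, (p : ℝ) ^ 2 * P := by
    rw [Finset.sum_const, card_arcs, nsmul_eq_mul]
    push_cast
    ring
  have hz : ∀ z ∈ G.arcs, |(p : ℝ) ^ ({z.1, z.2} : Finset V).card *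
        𝐁.real {T | G.arcsIn (T ∪ ({z.1, z.2} : Finset V)) = 2 * (a + 1) ∧
          G.loopsIn (T ∪ ({z.1, z.2} : Finset V)) = b} - (p : ℝ) ^ 2 * P| ≤
      (p : ℝ) ^ 2 * ((p * G.degree z.1 + if z.1 ∈ G.loops then 1 else 0) +
        (p * G.degree z.2 + if z.2 ∈ G.loops then 1 else 0)) := by
    rintro ⟨u, v⟩ hz
    rw [hcard _ hz, ← mul_sub, abs_mul, abs_of_nonneg (by positivity)]
    refine mul_le_mul_of_nonneg_left ?_ (by positivity)
    refine (abs_measureReal_sub_le _ _ _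
      (fun T => (∃ w ∈ G.nbrs u ∪ G.nbrs v, w ∈ T) ∨ (u ∈ G.loops ∨ v ∈ G.loops)) ?_).trans ?_
    · intro T hT
      simp only [not_or, not_exists, not_and] at hT
      rw [arcsIn_union_pair hz hT.1, loopsIn_union_pair hT.2.1 hT.2.2]
      omega
    -- As `u` and `v` are neighbours, the case that `u` or `v` itself lies in `T` is included.
    · refine (measureReal_union_le {T | ∃ w ∈ G.nbrs u ∪ G.nbrs v, w ∈ T} _).trans ?_
      have h3 : ((G.nbrs u ∪ G.nbrs v).card : ℝ) ≤ G.degree u + G.degree v := by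
        rw [← card_nbrs, ← card_nbrs]
        exact_mod_cast Finset.card_union_le _ _
      have h4 := (setBernoulli_real_exists_mem_le p (G.nbrs u ∪ G.nbrs v)).trans
        (mul_le_mul_of_nonneg_left h3 hp0)
      have h5 : 𝐁.real {T | u ∈ G.loops ∨ v ∈ G.loops} ≤
          (if u ∈ G.loops then 1 else 0) + if v ∈ G.loops then 1 else 0 := by
        by_cases hu : u ∈ G.loops
        · have : (0 : ℝ) ≤ if v ∈ G.loops then 1 else 0 := by split_ifs <;> norm_num
          rw [if_pos hu]
          linarith [measureReal_le_one (μ := 𝐁) (s := {T | u ∈ G.loops ∨ v ∈ G.loops})]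
        · by_cases hv : v ∈ G.loops
          · rw [if_neg hu, if_pos hv, zero_add]
            exact measureReal_le_one
          · simp [hu, hv]
      have h6 := add_le_add h4 h5
      refine h6.trans_eq ?_
      ring
  rw [h1, ← Finset.sum_sub_distrib]
  refine (Finset.abs_sum_le_sum_abs _ _).trans ((Finset.sum_le_sum hz).trans_eq ?_)
  have h7 : ∑ v, (G.degree v : ℝ) * (p * G.degree v + if v ∈ G.loops then 1 else 0) =
      p * G.sumSqDegree + G.sumLoopDegree := by
    simp only [mul_add, Finset.sum_add_distrib, sumSqDegree, sumLoopDegree, Finset.mul_sum]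
    congr 1
    · exact Finset.sum_congr rfl fun v _ => by ring
    · simp
  rw [← Finset.mul_sum, Finset.sum_add_distrib,
    sum_arcs_fst G (fun v => p * G.degree v + if v ∈ G.loops then 1 else 0),
    sum_arcs_snd G (fun v => p * G.degree v + if v ∈ G.loops then 1 else 0), h7]
  ring

/-- The Poisson recursion in the number of loops. -/
lemma abs_loops_recursion_le (a b : ℕ) :
    |((b + 1 : ℕ) : ℝ) * 𝐁.real {T | G.arcsIn T = 2 * a ∧ G.loopsIn T = b + 1} -
      (p : ℝ) * G.numLoops * 𝐁.real {T | G.arcsIn T = 2 * a ∧ G.loopsIn T = b}| ≤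
    (p : ℝ) ^ 2 * G.numLoops + (p : ℝ) ^ 2 * G.sumLoopDegree := by
  rw [card_mul_setBernoulli_real p G.loops (fun v => {v}) (b + 1)
    (fun T => G.arcsIn T = 2 * a ∧ G.loopsIn T = b + 1) (fun T hT => hT.2)]
  have hp0 : (0 : ℝ) ≤ p := p.2.1
  set P := 𝐁.real {T | G.arcsIn T = 2 * a ∧ G.loopsIn T = b} with hP
  have h1 : (p : ℝ) * G.numLoops * P = ∑ v ∈ G.loops, (p : ℝ) * P := by
    rw [Finset.sum_const, card_loops, nsmul_eq_mul]
    ring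
  have hz : ∀ v ∈ G.loops, |(p : ℝ) ^ ({v} : Finset V).card *
        𝐁.real {T | G.arcsIn (T ∪ ({v} : Finset V)) = 2 * a ∧
          G.loopsIn (T ∪ ({v} : Finset V)) = b + 1} - (p : ℝ) * P| ≤
      (p : ℝ) * (p + p * G.degree v) := by
    intro v hv
    rw [Finset.card_singleton, pow_one, ← mul_sub, abs_mul, abs_of_nonneg hp0]
    refine mul_le_mul_of_nonneg_left ?_ hp0
    refine (abs_measureReal_sub_le _ _ _
      (fun T => v ∈ T ∨ ∃ w ∈ G.nbrs v, w ∈ T) ?_).trans ?_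
    · intro T hT
      simp only [not_or, not_exists, not_and] at hT
      rw [arcsIn_union_singleton hT.2, loopsIn_union_singleton hv hT.1]
      omega
    · refine (measureReal_union_le {T | v ∈ T} _).trans (add_le_add ?_ ?_)
      · exact (setBernoulli_real_mem p v).le
      · rw [← card_nbrs]
        exact setBernoulli_real_exists_mem_le p _
  rw [h1, ← Finset.sum_sub_distrib]
  refine (Finset.abs_sum_le_sum_abs _ _).trans ((Finset.sum_le_sum hz).trans_eq ?_)
  rw [← Finset.mul_sum, Finset.sum_add_distrib, Finset.sum_const, card_loops, ← Finset.mul_sum,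
    nsmul_eq_mul, sumLoopDegree]
  ring

/-- If an induced subgraph is not a disjoint union of edges and loops, then it contains a path with
two edges, or a vertex with both a loop and an edge. -/
lemma setBernoulli_real_not_disjoint_le :
    𝐁.real {T | ¬ (G.restrict T).unlabel.IsDisjointEdgesLoops} ≤
      (p : ℝ) ^ 3 * G.sumSqDegree + (p : ℝ) ^ 2 * G.sumLoopDegree := by
  let S : Finset (V × V × V) := Finset.univ.filter fun z =>
    z.2.1 ∈ G.nbrs z.1 ∧ z.2.2 ∈ G.nbrs z.1 ∧ z.2.1 ≠ z.2.2
  let S' : Finset (V × V) := Finset.univ.filter fun z => z.1 ∈ G.loops ∧ z.2 ∈ G.nbrs z.1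
  have hp0 : (0 : ℝ) ≤ p := p.2.1
  have hsub : {T | ¬ (G.restrict T).unlabel.IsDisjointEdgesLoops} ⊆
      {T | ∃ z ∈ S, (({z.1, z.2.1, z.2.2} : Finset V) : Set V) ⊆ T} ∪
        {T | ∃ z ∈ S', (({z.1, z.2} : Finset V) : Set V) ⊆ T} := by
    intro T hT
    by_contra hcon
    refine hT (UnlabeledGraph.isDisjointEdgesLoops_unlabel (isDisjointEdgesLoops_restrict ?_))
    intro v hv u hu w hw hvu hvw
    by_contra huw
    simp only [Set.mem_union, Set.mem_ofPred_eq, not_or] at hcon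
    by_cases huv : u = v
    · subst huv
      exact hcon.2 ⟨(u, w), by simp [S', mem_loops, mem_nbrs, hvu, hvw, Ne.symm huw],
        by simp [Set.insert_subset_iff, hu, hw]⟩
    by_cases hwv : w = v
    · subst hwv
      exact hcon.2 ⟨(w, u), by simp [S', mem_loops, mem_nbrs, hvu, hvw, huw],
        by simp [Set.insert_subset_iff, hu, hw]⟩
    exact hcon.1 ⟨(v, u, w), by simp [S, mem_nbrs, hvu, hvw, huw, huv, hwv],
      by simp [Set.insert_subset_iff, hu, hv, hw]⟩
  refine (measureReal_mono hsub).trans ((measureReal_union_le _ _).trans (add_le_add ?_ ?_))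
  · refine (setBernoulli_real_exists_subset_le p S fun z => {z.1, z.2.1, z.2.2}).trans ?_
    have hc : ∀ z ∈ S, (p : ℝ) ^ ({z.1, z.2.1, z.2.2} : Finset V).card = (p : ℝ) ^ 3 := by
      rintro ⟨v, u, w⟩ hz
      simp only [S, Finset.mem_filter, mem_nbrs, Finset.mem_univ, true_and] at hz
      rw [Finset.card_eq_three.2 ⟨v, u, w, hz.1.1.symm, hz.2.1.1.symm, hz.2.2, rfl⟩]
    rw [Finset.sum_congr rfl hc, Finset.sum_const, nsmul_eq_mul, mul_comm]
    refine mul_le_mul_of_nonneg_left ?_ (by positivity)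
    have hS : S ⊆ (Finset.univ.sigma fun v => G.nbrs v ×ˢ G.nbrs v).image
        fun x => (x.1, x.2.1, x.2.2) := by
      rintro ⟨v, u, w⟩ hz
      simp only [S, Finset.mem_filter, Finset.mem_univ, true_and] at hz
      exact Finset.mem_image.2 ⟨⟨v, u, w⟩, by simp [hz.1, hz.2.1], rfl⟩
    have h := (Finset.card_le_card hS).trans Finset.card_image_le
    rw [Finset.card_sigma] at h
    simp only [Finset.card_product, card_nbrs] at h
    rw [sumSqDegree]
    simp only [pow_two]
    exact_mod_cast h
  · refine (setBernoulli_real_exists_subset_le p S' fun z => {z.1, z.2}).trans ?_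
    have hc : ∀ z ∈ S', (p : ℝ) ^ ({z.1, z.2} : Finset V).card = (p : ℝ) ^ 2 := by
      rintro ⟨v, u⟩ hz
      simp only [S', Finset.mem_filter, mem_nbrs, Finset.mem_univ, true_and] at hz
      rw [Finset.card_pair hz.2.1.symm]
    rw [Finset.sum_congr rfl hc, Finset.sum_const, nsmul_eq_mul, mul_comm]
    refine mul_le_mul_of_nonneg_left ?_ (by positivity)
    have hS : S' ⊆ (G.loops.sigma fun v => G.nbrs v).image fun x => (x.1, x.2) := by
      rintro ⟨v, u⟩ hz
      simp only [S', Finset.mem_filter, Finset.mem_univ, true_and] at hz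
      exact Finset.mem_image.2 ⟨⟨v, u⟩, by simp [hz.1, hz.2], rfl⟩
    have h := (Finset.card_le_card hS).trans Finset.card_image_le
    rw [Finset.card_sigma] at h
    simp only [card_nbrs] at h
    rw [sumLoopDegree]
    exact_mod_cast h

/-- The probability generating function of the number of sampled loops. -/
lemma integral_pow_loopsIn (a : ℝ) :
    ∫ T, a ^ G.loopsIn T ∂𝐁 = (1 - p * (1 - a)) ^ G.numLoops := by
  rw [← card_loops, ← integral_pow_card_setBernoulli]
  simp only [loopsIn, Finset.coe_singleton, Set.singleton_subset_iff]

lemma sumLoopDegree_nonneg : 0 ≤ G.sumLoopDegree :=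
  Finset.sum_nonneg fun _ _ => Nat.cast_nonneg _

lemma sumSqDegree_nonneg : 0 ≤ G.sumSqDegree :=
  Finset.sum_nonneg fun _ _ => sq_nonneg _

/-- The Cauchy-Schwarz inequality for the degrees of the vertices with a loop. -/
lemma sumLoopDegree_sq_le : G.sumLoopDegree ^ 2 ≤ G.numLoops * G.sumSqDegree := by
  rw [← card_loops, sumLoopDegree, sumSqDegree]
  refine (sq_sum_le_card_mul_sum_sq).trans ?_
  refine mul_le_mul_of_nonneg_left ?_ (by positivity)
  exact Finset.sum_le_sum_of_subset_of_nonneg (Finset.subset_univ _) fun _ _ _ => by positivity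

end LoopGraph

/-! ### The limit law of the sampled graphs -/

section LimitLaw

/-- Weak convergence on a discrete space is setwise convergence. -/
lemma tendsto_measureReal_of_discrete {Ω : Type*} [TopologicalSpace Ω] [DiscreteTopology Ω]
    [MeasurableSpace Ω] [BorelSpace Ω] {P : ℕ → ProbabilityMeasure Ω} {Q : ProbabilityMeasure Ω}
    (h : Tendsto P atTop (𝓝 Q)) (S : Set Ω) :
    Tendsto (fun j => (P j : Measure Ω).real S) atTop (𝓝 ((Q : Measure Ω).real S)) := by
  have := ProbabilityMeasure.tendsto_measure_of_null_frontier_of_tendsto' h (E := S)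
    (by simp [frontier, interior_eq_iff_isOpen.2 (isOpen_discrete S)])
  exact (ENNReal.tendsto_toReal (measure_ne_top _ _)).comp this

/-- A probability measure on `ℕ × ℕ` obeying the two Poisson recursions is a product of Poisson
measures. -/
lemma eq_prod_poissonMeasure_of_recursion (M : Measure (ℕ × ℕ)) [IsProbabilityMeasure M]
    (s t : ℝ≥0)
    (h1 : ∀ a b : ℕ, (a + 1 : ℝ) * M.real {(a + 1, b)} = s * M.real {(a, b)})
    (h2 : ∀ a b : ℕ, (b + 1 : ℝ) * M.real {(a, b + 1)} = t * M.real {(a, b)}) :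
    M = (poissonMeasure s).prod (poissonMeasure t) := by
  have hM : ∀ a b : ℕ, M.real {(a, b)} =
      M.real {(0, 0)} * (s ^ a / a.factorial * (t ^ b / b.factorial)) := by
    intro a b
    induction a with
    | zero =>
      induction b with
      | zero => simp
      | succ b ih =>
        have h : (b + 1 : ℝ) ≠ 0 := by positivity
        have h3 := h2 0 b
        rw [ih] at h3
        refine mul_left_cancel₀ h (h3.trans ?_)
        rw [Nat.factorial_succ]
        push_cast
        field_simp
        ring
    | succ a ih =>
      have h : (a + 1 : ℝ) ≠ 0 := by positivity
      have h3 := h1 a b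
      rw [ih] at h3
      refine mul_left_cancel₀ h (h3.trans ?_)
      rw [Nat.factorial_succ]
      push_cast
      field_simp
      ring
  -- The recursions determine `M` up to a factor, which is `1` since both masses are `1`.
  set c : ℝ := M.real {(0, 0)} * (Real.exp s * Real.exp t) with hc
  have hc0 : 0 ≤ c := by positivity
  have hcM : M = ENNReal.ofReal c • (poissonMeasure s).prod (poissonMeasure t) := by
    refine Measure.ext_of_singleton fun z => ?_
    obtain ⟨a, b⟩ := z
    rw [Measure.smul_apply, smul_eq_mul, ← Set.singleton_prod_singleton, Measure.prod_prod,
      Set.singleton_prod_singleton, poissonMeasure_singleton, poissonMeasure_singleton,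
      ← ENNReal.ofReal_mul (by positivity), ← ENNReal.ofReal_mul hc0,
      ← ofReal_measureReal, hM, hc]
    congr 1
    rw [Real.exp_neg, Real.exp_neg]
    field_simp
  have h1c : ENNReal.ofReal c = 1 := by
    have := congrArg (fun μ : Measure (ℕ × ℕ) => μ Set.univ) hcM
    simpa using this.symm
  rw [hcM, h1c, one_smul]

/-- If `(1 - p / 2) ^ L` converges to a positive number and `p → 0`, then `p * L` converges. -/
lemma tendsto_mul_of_tendsto_pow {p : ℕ → ℝ} {L : ℕ → ℕ} {κ : ℝ} (hκ : 0 < κ)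
    (hp : Tendsto p atTop (𝓝 0)) (hp0 : ∀ᶠ j in atTop, 0 < p j)
    (h : Tendsto (fun j => (1 - p j / 2) ^ L j) atTop (𝓝 κ)) :
    Tendsto (fun j => p j * L j) atTop (𝓝 (Real.log κ / (-1 / 2))) := by
  have h1 : Tendsto (fun j => L j * Real.log (1 - p j / 2)) atTop (𝓝 (Real.log κ)) := by
    have := ((Real.continuousAt_log hκ.ne').tendsto).comp h
    simpa [Function.comp_def, Real.log_pow] using this
  have hd : HasDerivAt (fun x : ℝ => Real.log (1 - x / 2)) (-1 / 2) 0 := by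
    have h2 : HasDerivAt (fun x : ℝ => 1 - x / 2) (-(1 / 2)) 0 :=
      ((hasDerivAt_id (0 : ℝ)).div_const 2).const_sub 1
    have h3 := h2.log (by norm_num)
    convert h3 using 1
    norm_num
  -- The quotient is the slope of `x ↦ log (1 - x / 2)` between `0` and `p j`.
  have h2 : Tendsto (fun j => Real.log (1 - p j / 2) / p j) atTop (𝓝 (-1 / 2)) := by
    have h3 := (hasDerivAt_iff_tendsto_slope.1 hd).comp
      (tendsto_nhdsWithin_iff.2 ⟨hp, hp0.mono fun j hj => hj.ne'⟩)
    refine h3.congr fun j => ?_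
    simp [slope_def_field]
  refine (h1.div h2 (by norm_num)).congr' ?_
  have h3 : ∀ᶠ j in atTop, Real.log (1 - p j / 2) / p j < 0 :=
    h2.eventually (gt_mem_nhds (by norm_num))
  filter_upwards [h3, hp0] with j h3 hj
  have h4 : Real.log (1 - p j / 2) ≠ 0 := fun e => by
    rw [e, zero_div] at h3
    exact lt_irrefl _ h3
  simp only [Pi.div_apply]
  rw [div_div_eq_mul_div, div_eq_iff h4]
  ring

lemma pSampling_real {V : Type*} [Fintype V] (G : LoopGraph V) (p : ℝ≥0)
    (S : Set UnlabeledGraph) :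
    (pSampling G p : Measure UnlabeledGraph).real S =
      (setBernoulli (Set.univ : Set V) (minOne p)).real {T | (G.restrict T).unlabel ∈ S} :=
  map_measureReal_apply .of_discrete .of_discrete

lemma tendsto_sqrt_numEdges {V : ℕ → Type*} (G : ∀ j, LoopGraph (V j))
    (he : Tendsto (fun j => (G j).numEdges) atTop atTop) :
    Tendsto (fun j => √(2 * ((G j).numEdges : ℝ))) atTop atTop :=
  Real.tendsto_sqrt_atTop.comp
    ((tendsto_natCast_atTop_atTop.comp he).const_mul_atTop (by norm_num))

/-- The probability with which a vertex of `G j` is included in the sampling with parameter `r`,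
cut off at `1`. -/
def sampleProb {V : ℕ → Type*} (G : ∀ j, LoopGraph (V j)) (r : ℝ≥0) (j : ℕ) : unitInterval :=
  minOne (r / NNReal.sqrt (2 * ((G j).numEdges : ℝ≥0)))

lemma eventually_sampleProb_eq {V : ℕ → Type*} (G : ∀ j, LoopGraph (V j))
    (he : Tendsto (fun j => (G j).numEdges) atTop atTop) (r : ℝ≥0) :
    ∀ᶠ j in atTop, (sampleProb G r j : ℝ) = r / √(2 * ((G j).numEdges : ℝ)) := by
  filter_upwards [(tendsto_sqrt_numEdges G he).eventually_ge_atTop (r + 1 : ℝ)] with j hj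
  have h : (r / NNReal.sqrt (2 * ((G j).numEdges : ℝ≥0)) : ℝ≥0) ≤ 1 := by
    rw [← NNReal.coe_le_coe]
    push_cast
    refine div_le_one_of_le₀ (by linarith) (Real.sqrt_nonneg _)
  rw [sampleProb, minOne]
  simp only [min_eq_left h]
  push_cast
  rfl

variable {V : ℕ → Type*} [∀ j, Fintype (V j)] (G : ∀ j, LoopGraph (V j))

/-- Both degree conditions say that the sum of the squared degrees is `o(e(G) ^ (3 / 2))`. -/
lemma tendsto_sumSqDegree (he : Tendsto (fun j => (G j).numEdges) atTop atTop)
    (hdeg : (fun j => ((G j).maxDegree : ℝ)) =o[atTop] (fun j => √((G j).numEdges : ℝ)) ∨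
      Tendsto (fun j => (G j).avgSqDegree / (G j).avgDegree ^ 2 * √(G j).edgeDensity)
        atTop (𝓝 0)) :
    Tendsto (fun j => (G j).sumSqDegree / √(2 * ((G j).numEdges : ℝ)) ^ 3) atTop (𝓝 0) := by
  have hsum : ∀ j, ∑ v, ((G j).degree v : ℝ) = 2 * (G j).numEdges := fun j => by
    exact_mod_cast (G j).sum_degree_eq_two_mul_numEdges
  rcases hdeg with h | h
  · have h1 := h.tendsto_div_nhds_zero
    refine squeeze_zero' (.of_forall fun j => ?_) ?_ h1
    · exact div_nonneg (G j).sumSqDegree_nonneg (by positivity)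
    · filter_upwards [he.eventually_ge_atTop 1] with j hj
      have hm : (0 : ℝ) < (G j).numEdges := by exact_mod_cast hj
      have h2 : (G j).sumSqDegree ≤ (G j).maxDegree * (2 * (G j).numEdges) := by
        rw [← hsum, Finset.mul_sum, LoopGraph.sumSqDegree]
        refine Finset.sum_le_sum fun v _ => ?_
        rw [sq]
        refine mul_le_mul_of_nonneg_right ?_ (by positivity)
        exact_mod_cast Finset.le_sup (f := (G j).degree) (Finset.mem_univ v)
      have h3 : √(2 * ((G j).numEdges : ℝ)) ^ 3 =
          2 * (G j).numEdges * √(2 * ((G j).numEdges : ℝ)) := by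
        rw [pow_succ, Real.sq_sqrt (by positivity)]
      rw [h3]
      calc (G j).sumSqDegree / (2 * (G j).numEdges * √(2 * ((G j).numEdges : ℝ)))
          ≤ (G j).maxDegree * (2 * (G j).numEdges) /
            (2 * (G j).numEdges * √(2 * ((G j).numEdges : ℝ))) := by gcongr
        _ = (G j).maxDegree / √(2 * ((G j).numEdges : ℝ)) := by field_simp
        _ ≤ (G j).maxDegree / √((G j).numEdges : ℝ) := by
          gcongr
          linarith
  · refine h.congr' ?_
    filter_upwards [he.eventually_ge_atTop 1] with j hj
    have hm : (0 : ℝ) < (G j).numEdges := by exact_mod_cast hj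
    have hv : (0 : ℝ) < Fintype.card (V j) := by
      by_contra hcon
      have h0 : Fintype.card (V j) = 0 := by
        by_contra h0
        exact hcon (by exact_mod_cast Nat.pos_of_ne_zero h0)
      have : IsEmpty (V j) := Fintype.card_eq_zero_iff.1 h0
      have := hsum j
      simp at this
      omega
    set x := √(2 * ((G j).numEdges : ℝ)) with hx
    have hx0 : x ≠ 0 := by positivity
    have hx2 : 2 * ((G j).numEdges : ℝ) = x ^ 2 := (Real.sq_sqrt (by positivity)).symm
    rw [LoopGraph.avgSqDegree, LoopGraph.avgDegree, LoopGraph.edgeDensity, hsum,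
      Real.sqrt_div (by positivity), Real.sqrt_sq hv.le, ← hx, hx2, LoopGraph.sumSqDegree]
    field_simp

/-- Sampling convergence controls the number of loops: the probability generating function of the
number of sampled loops has a positive limit. -/
lemma exists_tendsto_numLoops (hG : SamplingConvergent G)
    (he : Tendsto (fun j => (G j).numEdges) atTop atTop) :
    ∃ l : ℝ≥0, Tendsto (fun j => ((G j).numLoops : ℝ) / √(2 * ((G j).numEdges : ℝ))) atTop
      (𝓝 l) := by
  obtain ⟨Q, hQ⟩ := hG 1
  let f : BoundedContinuousFunction UnlabeledGraph ℝ :=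
    BoundedContinuousFunction.ofNormedAddCommGroupDiscrete
      (fun H => (1 / 2 : ℝ) ^ H.edgesLoops.2) 1 fun H => by
        rw [Real.norm_of_nonneg (by positivity)]
        exact pow_le_one₀ (by norm_num) (by norm_num)
  have hf := (ProbabilityMeasure.tendsto_iff_forall_integral_tendsto.1 hQ) f
  have hκ : 0 < ∫ H, f H ∂(Q : Measure UnlabeledGraph) := by
    have hf0 : 0 ≤ fun H => f H := fun H =>
      show (0 : ℝ) ≤ (1 / 2 : ℝ) ^ H.edgesLoops.2 by positivity
    rw [integral_pos_iff_support_of_nonneg hf0 (f.integrable _)]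
    have : Function.support f = Set.univ := by
      ext H
      simp only [Function.mem_support, Set.mem_univ, iff_true]
      exact (show (0 : ℝ) < (1 / 2 : ℝ) ^ H.edgesLoops.2 by positivity).ne'
    rw [this]
    simp
  have hx := tendsto_sqrt_numEdges G he
  have hp : Tendsto (fun j => (1 : ℝ) / √(2 * ((G j).numEdges : ℝ))) atTop (𝓝 0) := by
    exact hx.inv_tendsto_atTop.congr fun j => (one_div _).symm
  have hlim := tendsto_mul_of_tendsto_pow (L := fun j => (G j).numLoops) hκ hp
    ((hx.eventually_gt_atTop 0).mono fun j hj => by positivity) <| by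
      refine hf.congr' ?_
      filter_upwards [eventually_sampleProb_eq G he 1] with j hj
      have h1 : ∫ H, f H ∂(samplingDist (G j) 1 : Measure UnlabeledGraph) =
          ∫ T, f ((G j).restrict T).unlabel
            ∂(setBernoulli (Set.univ : Set (V j)) (sampleProb G 1 j)) :=
        integral_map Measurable.of_discrete.aemeasurable
          f.continuous.measurable.aestronglyMeasurable
      have h2 : ∀ T : Set (V j), f ((G j).restrict T).unlabel = (1 / 2 : ℝ) ^ (G j).loopsIn T := by
        intro T
        rw [LoopGraph.loopsIn_eq]
        change (1 / 2 : ℝ) ^ ((G j).restrict T).unlabel.edgesLoops.2 = _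
        rw [UnlabeledGraph.edgesLoops_unlabel]
      rw [h1]
      simp_rw [h2]
      rw [LoopGraph.integral_pow_loopsIn, hj]
      congr 1
      push_cast
      ring
  have hlim' : Tendsto (fun j => ((G j).numLoops : ℝ) / √(2 * ((G j).numEdges : ℝ))) atTop
      (𝓝 (Real.log (∫ H, f H ∂(Q : Measure UnlabeledGraph)) / (-1 / 2))) :=
    hlim.congr fun j => by ring
  have h0 := ge_of_tendsto' hlim' fun j => by positivity
  exact ⟨⟨_, h0⟩, hlim'⟩

variable {G}

lemma tendsto_sumLoopDegree {l : ℝ≥0}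
    (hS : Tendsto (fun j => (G j).sumSqDegree / √(2 * ((G j).numEdges : ℝ)) ^ 3) atTop (𝓝 0))
    (hl : Tendsto (fun j => ((G j).numLoops : ℝ) / √(2 * ((G j).numEdges : ℝ))) atTop (𝓝 l)) :
    Tendsto (fun j => (G j).sumLoopDegree / √(2 * ((G j).numEdges : ℝ)) ^ 2) atTop (𝓝 0) := by
  have h1 : Tendsto (fun j => √((G j).numLoops / √(2 * ((G j).numEdges : ℝ)) *
      ((G j).sumSqDegree / √(2 * ((G j).numEdges : ℝ)) ^ 3))) atTop (𝓝 0) := by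
    simpa using (hl.mul hS).sqrt
  refine squeeze_zero (fun j => div_nonneg (G j).sumLoopDegree_nonneg (by positivity))
    (fun j => ?_) h1
  refine Real.le_sqrt_of_sq_le ?_
  rw [div_pow, div_mul_div_comm]
  have h2 : (√(2 * ((G j).numEdges : ℝ)) ^ 2) ^ 2 =
      √(2 * ((G j).numEdges : ℝ)) * √(2 * ((G j).numEdges : ℝ)) ^ 3 := by ring
  rw [h2]
  exact div_le_div_of_nonneg_right (G j).sumLoopDegree_sq_le (by positivity)

/-- The expected number of pairs of adjacent edges, or of an edge and a loop with a common vertex,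
tends to zero. -/
lemma tendsto_error {l : ℝ≥0} (he : Tendsto (fun j => (G j).numEdges) atTop atTop)
    (hS : Tendsto (fun j => (G j).sumSqDegree / √(2 * ((G j).numEdges : ℝ)) ^ 3) atTop (𝓝 0))
    (hl : Tendsto (fun j => ((G j).numLoops : ℝ) / √(2 * ((G j).numEdges : ℝ))) atTop (𝓝 l))
    (r : ℝ≥0) :
    Tendsto (fun j => (sampleProb G r j : ℝ) ^ 3 * (G j).sumSqDegree +
      (sampleProb G r j : ℝ) ^ 2 * (G j).sumLoopDegree) atTop (𝓝 0) := by
  have h : Tendsto (fun j => (r : ℝ) ^ 3 * ((G j).sumSqDegree / √(2 * ((G j).numEdges : ℝ)) ^ 3) +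
      (r : ℝ) ^ 2 * ((G j).sumLoopDegree / √(2 * ((G j).numEdges : ℝ)) ^ 2)) atTop (𝓝 0) := by
    simpa using (hS.const_mul ((r : ℝ) ^ 3)).add
      ((tendsto_sumLoopDegree hS hl).const_mul ((r : ℝ) ^ 2))
  refine h.congr' ?_
  filter_upwards [eventually_sampleProb_eq G he r] with j hj
  rw [hj]
  ring

lemma samplingDist_real (G : ∀ j, LoopGraph (V j)) (r : ℝ≥0) (j : ℕ) (S : Set UnlabeledGraph) :
    (samplingDist (G j) r : Measure UnlabeledGraph).real S =
      (setBernoulli (Set.univ : Set (V j)) (sampleProb G r j)).real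
        {T | ((G j).restrict T).unlabel ∈ S} :=
  pSampling_real _ _ _

lemma samplingDist_real_edgesLoops (G : ∀ j, LoopGraph (V j)) (r : ℝ≥0) (j a b : ℕ) :
    (samplingDist (G j) r : Measure UnlabeledGraph).real {H | H.edgesLoops = (a, b)} =
      (setBernoulli (Set.univ : Set (V j)) (sampleProb G r j)).real
        {T | (G j).arcsIn T = 2 * a ∧ (G j).loopsIn T = b} := by
  rw [samplingDist_real]
  congr 1
  ext T
  exact LoopGraph.edgesLoops_restrict_eq_iff (G j) T a b

lemma tendsto_samplingDist_disjoint {l : ℝ≥0}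
    (he : Tendsto (fun j => (G j).numEdges) atTop atTop)
    (hS : Tendsto (fun j => (G j).sumSqDegree / √(2 * ((G j).numEdges : ℝ)) ^ 3) atTop (𝓝 0))
    (hl : Tendsto (fun j => ((G j).numLoops : ℝ) / √(2 * ((G j).numEdges : ℝ))) atTop (𝓝 l))
    (r : ℝ≥0) :
    Tendsto (fun j => (samplingDist (G j) r : Measure UnlabeledGraph).real
      {H | ¬ H.IsDisjointEdgesLoops}) atTop (𝓝 0) := by
  refine squeeze_zero (fun _ => measureReal_nonneg) (fun j => ?_) (tendsto_error he hS hl r)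
  rw [samplingDist_real]
  exact LoopGraph.setBernoulli_real_not_disjoint_le (G j) (sampleProb G r j)

/-- The limit of the samplings has independent Poisson numbers of edges and of loops. -/
lemma map_edgesLoops_limit {l : ℝ≥0} (he : Tendsto (fun j => (G j).numEdges) atTop atTop)
    (hS : Tendsto (fun j => (G j).sumSqDegree / √(2 * ((G j).numEdges : ℝ)) ^ 3) atTop (𝓝 0))
    (hl : Tendsto (fun j => ((G j).numLoops : ℝ) / √(2 * ((G j).numEdges : ℝ))) atTop (𝓝 l))
    (r : ℝ≥0) {Q : ProbabilityMeasure UnlabeledGraph}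
    (hQ : Tendsto (fun j => samplingDist (G j) r) atTop (𝓝 Q)) :
    (Q : Measure UnlabeledGraph).map UnlabeledGraph.edgesLoops =
      (poissonMeasure (r ^ 2 / 2)).prod (poissonMeasure (r * l)) := by
  have hq : ∀ z, ((Q : Measure UnlabeledGraph).map UnlabeledGraph.edgesLoops).real {z} =
      (Q : Measure UnlabeledGraph).real {H | H.edgesLoops = z} := fun z =>
    map_measureReal_apply .of_discrete .of_discrete
  have hlim : ∀ a b : ℕ, Tendsto (fun j =>
      (setBernoulli (Set.univ : Set (V j)) (sampleProb G r j)).real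
        {T | (G j).arcsIn T = 2 * a ∧ (G j).loopsIn T = b}) atTop
      (𝓝 ((Q : Measure UnlabeledGraph).real {H | H.edgesLoops = (a, b)})) := by
    intro a b
    simp_rw [← samplingDist_real_edgesLoops]
    exact tendsto_measureReal_of_discrete hQ _
  have hx := tendsto_sqrt_numEdges G he
  have herr := tendsto_error he hS hl r
  have hpL : Tendsto (fun j => (sampleProb G r j : ℝ) * (G j).numLoops) atTop (𝓝 (r * l)) := by
    refine (hl.const_mul (r : ℝ)).congr' ?_
    filter_upwards [eventually_sampleProb_eq G he r] with j hj
    rw [hj]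
    ring
  have hp : Tendsto (fun j => (sampleProb G r j : ℝ)) atTop (𝓝 0) := by
    have h : Tendsto (fun j => (r : ℝ) * (√(2 * ((G j).numEdges : ℝ)))⁻¹) atTop (𝓝 0) := by
      have h0 := hx.inv_tendsto_atTop.const_mul (r : ℝ)
      rwa [mul_zero] at h0
    refine h.congr' ?_
    filter_upwards [eventually_sampleProb_eq G he r] with j hj
    rw [hj]
    ring
  have hpE : Tendsto (fun j => (sampleProb G r j : ℝ) ^ 2 * (2 * (G j).numEdges)) atTop
      (𝓝 ((r : ℝ) ^ 2)) := by
    refine tendsto_const_nhds.congr' ?_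
    filter_upwards [eventually_sampleProb_eq G he r, hx.eventually_gt_atTop 0] with j hj hj0
    rw [hj, div_pow, Real.sq_sqrt (by positivity)]
    have : (0 : ℝ) < 2 * (G j).numEdges := Real.sqrt_pos.1 hj0
    exact (div_mul_cancel₀ _ this.ne').symm
  have := Measure.isProbabilityMeasure_map (μ := (Q : Measure UnlabeledGraph))
    (f := UnlabeledGraph.edgesLoops) Measurable.of_discrete.aemeasurable
  refine eq_prod_poissonMeasure_of_recursion _ _ _ (fun a b => ?_) fun a b => ?_
  · rw [hq, hq]
    have h1 := ((hlim (a + 1) b).const_mul ((2 * (a + 1) : ℕ) : ℝ)).sub (hpE.mul (hlim a b))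
    have h2 := tendsto_nhds_unique h1 (squeeze_zero_norm
      (fun j => LoopGraph.abs_arcs_recursion_le (G j) (sampleProb G r j) a b)
      (by simpa using herr.const_mul 2))
    push_cast at h2 ⊢
    linarith
  · rw [hq, hq]
    have h1 := ((hlim a (b + 1)).const_mul ((b + 1 : ℕ) : ℝ)).sub (hpL.mul (hlim a b))
    have herr2 : Tendsto (fun j => (sampleProb G r j : ℝ) * ((sampleProb G r j : ℝ) *
        (G j).numLoops) + ((sampleProb G r j : ℝ) ^ 3 * (G j).sumSqDegree +
      (sampleProb G r j : ℝ) ^ 2 * (G j).sumLoopDegree)) atTop (𝓝 0) := by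
      simpa using (hp.mul hpL).add herr
    have h2 := tendsto_nhds_unique h1 (squeeze_zero_norm
      (fun j => (LoopGraph.abs_loops_recursion_le (G j) (sampleProb G r j) a b).trans ?_) herr2)
    · push_cast at h2 ⊢
      linarith
    · have h3 : (0 : ℝ) ≤ (sampleProb G r j : ℝ) ^ 3 * (G j).sumSqDegree :=
        mul_nonneg (pow_nonneg (sampleProb G r j).2.1 3) (G j).sumSqDegree_nonneg
      linarith

end LimitLaw

/-! ### Poisson processes: points in boxes -/

section PoissonCount

open scoped Classical

/-- The number of the first `n` terms of a sequence that belong to `A`. -/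
def countIn {E : Type*} (A : Set E) (z : ℕ × (ℕ → E)) : ℕ :=
  ∑ m ∈ Finset.range z.1, if z.2 m ∈ A then 1 else 0

lemma measurable_countIn {E : Type*} [MeasurableSpace E] {A : Set E} (hA : MeasurableSet A) :
    Measurable (countIn A) := by
  refine measurable_from_prod_countable_right fun n => ?_
  simp only [countIn]
  exact Finset.measurable_fun_sum _ fun m _ =>
    Measurable.ite (measurable_pi_apply m hA) measurable_const measurable_const

lemma integral_pow_countIn {E : Type*} [MeasurableSpace E] (ν : Measure E)
    [IsProbabilityMeasure ν] {A : Set E} (hA : MeasurableSet A) (c : ℂ) (n : ℕ) :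
    ∫ u, c ^ countIn A (n, u) ∂(Measure.infinitePi fun _ : ℕ => ν) =
      (1 + ν.real A * (c - 1)) ^ n := by
  have hm : Measurable fun x : E => if x ∈ A then c else 1 :=
    Measurable.ite hA measurable_const measurable_const
  have hind : iIndepFun (fun (m : Fin n) (u : ℕ → E) => if u m ∈ A then c else 1)
      (Measure.infinitePi fun _ : ℕ => ν) :=
    (iIndepFun_infinitePi (P := fun _ : ℕ => ν) (X := fun _ x => if x ∈ A then c else 1)
      fun _ => hm).precomp Fin.val_injective
  have h1 : ∀ u : ℕ → E, c ^ countIn A (n, u) = ∏ m : Fin n, if u m ∈ A then c else 1 := by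
    intro u
    rw [countIn, Finset.prod_fin_eq_prod_range, ← Finset.prod_pow_eq_pow_sum]
    refine Finset.prod_congr rfl fun m hm => ?_
    rw [dif_pos (Finset.mem_range.1 hm)]
    split_ifs <;> simp
  have h2 : ∀ m : Fin n, ∫ u : ℕ → E, (if u m ∈ A then c else 1)
      ∂(Measure.infinitePi fun _ : ℕ => ν) = 1 + ν.real A * (c - 1) := by
    intro m
    have h3 : ∫ u : ℕ → E, (if u m ∈ A then c else 1)
        ∂(Measure.infinitePi fun _ : ℕ => ν) = ∫ x, (if x ∈ A then c else 1) ∂ν := by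
      have h5 := integral_map (μ := Measure.infinitePi fun _ : ℕ => ν)
        (measurable_pi_apply (m : ℕ)).aemeasurable hm.aestronglyMeasurable
      rw [Measure.infinitePi_map_eval (fun _ : ℕ => ν) (m : ℕ)] at h5
      exact h5.symm
    have h4 : ∀ x : E, (if x ∈ A then c else 1) = 1 + A.indicator (fun _ => c - 1) x := by
      intro x
      by_cases hx : x ∈ A <;> simp [hx]
    rw [h3]
    simp_rw [h4]
    rw [integral_add (integrable_const _) ((integrable_const _).indicator hA),
      integral_indicator_const _ hA]
    simp
  simp_rw [h1]
  rw [hind.integral_fun_prod_eq_prod_integral fun m =>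
    (hm.comp (measurable_pi_apply _)).aestronglyMeasurable]
  simp [h2]

/-- Poisson thinning: if each of a Poisson number of points is retained independently, then the
number of retained points is Poisson. -/
lemma hasLaw_countIn {E : Type*} [MeasurableSpace E] (ν : Measure E)
    [IsProbabilityMeasure ν] {A : Set E} (hA : MeasurableSet A) {q : ℝ≥0} (hq : ν A = q) :
    HasLaw (countIn A) (poissonMeasure q)
      ((poissonMeasure 1).prod (Measure.infinitePi fun _ : ℕ => ν)) := by
  refine ⟨(measurable_countIn hA).aemeasurable, ?_⟩
  apply (MeasurableEmbedding.natCast (α := ℝ)).map_injective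
  -- Given the number `n` of points, the characteristic function of the number of retained points is
  -- `(1 + q * (c - 1)) ^ n` with `c = exp (t * I)`; averaging over `n` gives an exponential series.
  refine Measure.ext_of_charFun ?_
  ext t
  have hc : ∀ k : ℕ, Complex.exp (t * ((k : ℝ) : ℂ) * Complex.I) =
      Complex.exp (t * Complex.I) ^ k := by
    intro k
    rw [← Complex.exp_nat_mul]
    congr 1
    push_cast
    ring
  set c := Complex.exp (t * Complex.I) with hcdef
  have hm : Measurable fun k : ℕ => c ^ k := .of_discrete
  rw [charFun_map_cast_poissonMeasure, charFun_apply_real,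
    integral_map .of_discrete (by fun_prop)]
  simp_rw [hc]
  rw [integral_map (measurable_countIn hA).aemeasurable hm.aestronglyMeasurable,
    integral_prod]
  · simp_rw [integral_pow_countIn ν hA]
    have hqr : ν.real A = q := by simp [measureReal_def, hq]
    rw [hqr, integral_poissonMeasure]
    have h1 : ∀ n : ℕ, (Real.exp (-(1 : ℝ≥0)) * ((1 : ℝ≥0) : ℝ) ^ n / n.factorial) •
        (1 + ((q : ℝ) : ℂ) * (c - 1)) ^ n =
        Complex.exp (-1) * ((1 + ((q : ℝ) : ℂ) * (c - 1)) ^ n / n.factorial) := by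
      intro n
      rw [Complex.real_smul]
      push_cast
      ring
    simp_rw [h1]
    rw [tsum_mul_left, (NormedSpace.expSeries_div_hasSum_exp (1 + ((q : ℝ) : ℂ) * (c - 1))).tsum_eq,
      ← Complex.exp_eq_exp_ℂ, ← Complex.exp_add]
    congr 1
    ring
  · refine Integrable.of_bound (C := 1) (hm.comp (measurable_countIn hA)).aestronglyMeasurable ?_
    refine .of_forall fun z => ?_
    rw [norm_pow, hcdef, Complex.norm_exp_ofReal_mul_I, one_pow]

lemma hasLaw_sum_poissonMeasure {Ω ι : Type*} [MeasurableSpace Ω] {P : Measure Ω}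
    [IsProbabilityMeasure P] {X : ι → Ω → ℕ} (hm : ∀ i, Measurable (X i)) (hX : iIndepFun X P)
    {q : ι → ℝ≥0} (hq : ∀ i, HasLaw (X i) (poissonMeasure (q i)) P) (s : Finset ι) :
    HasLaw (∑ i ∈ s, X i) (poissonMeasure (∑ i ∈ s, q i)) P := by
  induction s using Finset.induction_on with
  | empty =>
    have h : poissonMeasure 0 = Measure.dirac 0 := by
      refine Measure.ext_of_singleton fun n => ?_
      rw [poissonMeasure_singleton]
      rcases n with _ | n <;> simp
    rw [Finset.sum_empty, Finset.sum_empty, h]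
    exact hasLaw_dirac_of_ae_eq (.of_forall fun _ => rfl)
  | insert i s hi ih =>
    rw [Finset.sum_insert hi, Finset.sum_insert hi]
    exact (hX.indepFun_finsetSum_of_notMem hm hi).symm.hasLaw_add_poissonMeasure (hq i) ih

lemma volume_unitInterval_add_le (k s : ℝ≥0) :
    volume {x : unitInterval | k + unitInterval.toNNReal x ≤ s} =
      if k ≤ s then ((min (s - k) 1 : ℝ≥0) : ℝ≥0∞) else 0 := by
  split_ifs with h
  · have hset : {x : unitInterval | k + unitInterval.toNNReal x ≤ s} =
        Set.Iic (⟨((min (s - k) 1 : ℝ≥0) : ℝ), NNReal.coe_nonneg _,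
          by exact_mod_cast min_le_right _ _⟩ : unitInterval) := by
      ext x
      simp only [Set.mem_ofPred_eq, Set.mem_Iic]
      rw [← Subtype.coe_le_coe, add_comm, ← le_tsub_iff_right h]
      have hx : unitInterval.toNNReal x ≤ 1 := x.2.2
      constructor
      · intro h'
        have : unitInterval.toNNReal x ≤ min (s - k) 1 := le_min h' hx
        exact_mod_cast this
      · intro h'
        have : unitInterval.toNNReal x ≤ min (s - k) 1 := by exact_mod_cast h'
        exact this.trans (min_le_left _ _)
    rw [hset, unitInterval.volume_Iic]
    simp
  · convert measure_empty (μ := (volume : Measure unitInterval))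
    refine Set.eq_empty_of_forall_notMem fun x hx => h ?_
    exact le_trans le_self_add hx

/-- The lengths of the intersections of `[0, s]` with the first `M` unit intervals add up to
`min s M`. -/
lemma sum_range_min_tsub (s : ℝ≥0) (M : ℕ) :
    ∑ k ∈ Finset.range M, min (s - (k : ℝ≥0)) 1 = min s M := by
  induction M with
  | zero => simp
  | succ M ih =>
    rw [Finset.sum_range_succ, ih]
    push_cast
    rcases le_total s M with h | h
    · rw [min_eq_left h, tsub_eq_zero_of_le h, min_eq_left (zero_le_one), add_zero,
        min_eq_left (h.trans le_self_add)]
    · obtain ⟨x, rfl⟩ := exists_add_of_le h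
      rw [min_eq_right h, add_tsub_cancel_left, min_add_add_left]

/-- The indices of the points of a Poisson process in the box `∏ a, [0, s a]`. -/
def pointsIn {d : ℕ} (s : Fin d → ℝ≥0) (ω : PoissonSpace d) : Set (PointIndex d) :=
  {i | IsPoint ω i ∧ ∀ a, position ω i a ≤ s a}

/-- The box `∏ a, [0, s a]` relative to the unit cube at `k`. -/
def relBox {d : ℕ} (s : Fin d → ℝ≥0) (k : Fin d → ℕ) : Set (Fin d → unitInterval) :=
  Set.univ.pi fun a => {x | (k a : ℝ≥0) + unitInterval.toNNReal x ≤ s a}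

lemma measurableSet_relBox {d : ℕ} (s : Fin d → ℝ≥0) (k : Fin d → ℕ) :
    MeasurableSet (relBox s k) := by
  refine MeasurableSet.univ_pi fun a => ?_
  refine (isClosed_le ?_ continuous_const).measurableSet
  exact continuous_const.add (continuous_subtype_val.subtype_mk fun x => x.2.1)

/-- A finite set of cubes containing all those that meet the box: the cubes whose lower corner
lies in the box. -/
def boxCubes {d : ℕ} (s : Fin d → ℝ≥0) : Finset (Fin d → ℕ) :=
  Fintype.piFinset fun a => Finset.range (⌊s a⌋₊ + 1)

lemma mem_boxCubes_of_mem_pointsIn {d : ℕ} {s : Fin d → ℝ≥0} {ω : PoissonSpace d}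
    {i : PointIndex d} (hi : i ∈ pointsIn s ω) : i.1 ∈ boxCubes s := by
  rw [boxCubes, Fintype.mem_piFinset]
  intro a
  rw [Finset.mem_range, Nat.lt_succ_iff]
  exact Nat.le_floor (le_self_add.trans (hi.2 a))

lemma pointsIn_eq {d : ℕ} (s : Fin d → ℝ≥0) (ω : PoissonSpace d) :
    pointsIn s ω = ((((boxCubes s).sigma fun k =>
      (Finset.range (ω k).1).filter fun m => (ω k).2 m ∈ relBox s k).image
        fun x : (_ : Fin d → ℕ) × ℕ => (x.1, x.2) : Finset (PointIndex d)) :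
          Set (PointIndex d)) := by
  ext ⟨k, m⟩
  simp only [Finset.coe_image, Set.mem_image, Finset.mem_coe, Finset.mem_sigma,
    Finset.mem_filter, Finset.mem_range, Prod.mk.injEq, Sigma.exists]
  constructor
  · intro h
    exact ⟨k, m, ⟨mem_boxCubes_of_mem_pointsIn h, h.1, fun a _ => h.2 a⟩, rfl, rfl⟩
  · rintro ⟨k, m, ⟨_, h1, h2⟩, rfl, rfl⟩
    exact ⟨h1, fun a => h2 a (Set.mem_univ a)⟩

lemma finite_pointsIn {d : ℕ} (s : Fin d → ℝ≥0) (ω : PoissonSpace d) : (pointsIn s ω).Finite := by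
  rw [pointsIn_eq]
  exact Finset.finite_toSet _

lemma ncard_pointsIn {d : ℕ} (s : Fin d → ℝ≥0) (ω : PoissonSpace d) :
    (pointsIn s ω).ncard = ∑ k ∈ boxCubes s, countIn (relBox s k) (ω k) := by
  rw [pointsIn_eq, Set.ncard_coe_finset, Finset.card_image_of_injective, Finset.card_sigma]
  · refine Finset.sum_congr rfl fun k _ => ?_
    rw [countIn, Finset.sum_boole, Nat.cast_id]
  · rintro ⟨a, b⟩ ⟨a', b'⟩ h
    simp only [Prod.mk.injEq] at h
    obtain ⟨rfl, rfl⟩ := h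
    rfl

lemma measurable_ncard_pointsIn {d : ℕ} (s : Fin d → ℝ≥0) :
    Measurable fun ω : PoissonSpace d => (pointsIn s ω).ncard := by
  simp_rw [ncard_pointsIn]
  exact Finset.measurable_fun_sum _ fun k _ =>
    (measurable_countIn (measurableSet_relBox s k)).comp (measurable_pi_apply k)

/-- The number of points of a unit rate Poisson process in a box is a Poisson variable whose rate
is the volume of the box. -/
lemma hasLaw_ncard_pointsIn {d : ℕ} (s : Fin d → ℝ≥0) :
    HasLaw (fun ω => (pointsIn s ω).ncard) (poissonMeasure (∏ a, s a)) (poissonProcess d) := by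
  let f : ℝ≥0 → ℕ → ℝ≥0 := fun s k => min (s - (k : ℝ≥0)) 1
  have hrate : ∑ k ∈ boxCubes s, ∏ a, f (s a) (k a) = ∏ a, s a := by
    rw [boxCubes, ← Finset.prod_univ_sum]
    refine Finset.prod_congr rfl fun a _ => ?_
    rw [sum_range_min_tsub, min_eq_left]
    push_cast
    exact (Nat.lt_floor_add_one (s a)).le
  have hvol : ∀ k : Fin d → ℕ, Measure.pi (fun _ : Fin d => (volume : Measure unitInterval))
      (relBox s k) = ((∏ a, f (s a) (k a) : ℝ≥0) : ℝ≥0∞) := by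
    intro k
    rw [relBox, Measure.pi_pi]
    push_cast
    refine Finset.prod_congr rfl fun a _ => ?_
    rw [volume_unitInterval_add_le]
    split_ifs with h
    · rfl
    · simp [f, tsub_eq_zero_of_le (le_of_not_ge h)]
  have hsum : (fun ω : PoissonSpace d => (pointsIn s ω).ncard) =
      ∑ k ∈ boxCubes s, fun ω : PoissonSpace d => countIn (relBox s k) (ω k) := by
    ext ω
    rw [ncard_pointsIn, Finset.sum_apply]
  rw [hsum, ← hrate]
  have hm := fun k : Fin d → ℕ => measurable_countIn (measurableSet_relBox s k)
  refine hasLaw_sum_poissonMeasure (fun k => (hm k).comp (measurable_pi_apply k)) ?_ ?_ _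
  · exact iIndepFun_infinitePi hm
  · intro k
    exact (hasLaw_countIn _ (measurableSet_relBox s k) (hvol k)).fun_comp
      ⟨(measurable_pi_apply k).aemeasurable, Measure.infinitePi_map_eval _ k⟩

end PoissonCount

/-! ### Poisson processes: distinctness of positions -/

section PoissonDistinct

variable {d : ℕ}

lemma measurable_unitInterval_toNNReal : Measurable unitInterval.toNNReal :=
  measurable_subtype_coe.subtype_mk

lemma measurable_position (i : PointIndex d) (a : Fin d) :
    Measurable fun ω : PoissonSpace d => position ω i a := by
  have h := measurable_unitInterval_toNNReal
  unfold position
  fun_prop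

lemma hasLaw_relPositions (k : Fin d → ℕ) :
    HasLaw (fun ω : PoissonSpace d => (ω k).2)
      (Measure.infinitePi fun _ : ℕ => Measure.pi fun _ : Fin d => (volume : Measure unitInterval))
      (poissonProcess d) :=
  HasLaw.fun_comp (μ := (poissonMeasure 1).prod (Measure.infinitePi fun _ : ℕ =>
      Measure.pi fun _ : Fin d => (volume : Measure unitInterval))) (Y := Prod.snd)
    ⟨measurable_snd.aemeasurable, by simp⟩
    ⟨(measurable_pi_apply k).aemeasurable, Measure.infinitePi_map_eval _ k⟩

lemma hasLaw_relPosition (i : PointIndex d) :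
    HasLaw (fun ω : PoissonSpace d => (ω i.1).2 i.2)
      (Measure.pi fun _ : Fin d => (volume : Measure unitInterval)) (poissonProcess d) :=
  HasLaw.fun_comp (Y := fun u : ℕ → Fin d → unitInterval => u i.2)
    ⟨(measurable_pi_apply _).aemeasurable, Measure.infinitePi_map_eval _ i.2⟩
    (hasLaw_relPositions i.1)

lemma hasLaw_relCoordinate (i : PointIndex d) (a : Fin d) :
    HasLaw (fun ω : PoissonSpace d => (ω i.1).2 i.2 a) (volume : Measure unitInterval)
      (poissonProcess d) :=
  HasLaw.fun_comp (Y := fun u : Fin d → unitInterval => u a)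
    (measurePreserving_eval (fun _ : Fin d => (volume : Measure unitInterval)) a).hasLaw
    (hasLaw_relPosition i)

/-- The relative positions of the potential points in their cubes are independent. -/
lemma iIndepFun_relPosition :
    iIndepFun (fun (i : PointIndex d) (ω : PoissonSpace d) => (ω i.1).2 i.2)
      (poissonProcess d) := by
  refine iIndepFun_uncurry' (X := fun (k : Fin d → ℕ) (m : ℕ) (ω : PoissonSpace d) => (ω k).2 m)
    (by fun_prop) ?_ fun k => ?_
  · exact iIndepFun_infinitePi
      (X := fun (_ : Fin d → ℕ) (z : ℕ × (ℕ → Fin d → unitInterval)) => z.2)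
      fun _ => measurable_snd
  · exact (iIndepFun_iff_hasLaw_Pi_infinitePi (fun m => hasLaw_relPosition (k, m))
      (hasLaw_relPositions k).aemeasurable).2 (hasLaw_relPositions k)

lemma subsingleton_add_toNNReal_eq (c c' : ℝ≥0) :
    {x : unitInterval | c + unitInterval.toNNReal x = c'}.Subsingleton := by
  intro x hx y hy
  have h : unitInterval.toNNReal x = unitInterval.toNNReal y :=
    add_left_cancel (a := c) (hx.trans (Eq.symm hy))
  exact Subtype.ext (congrArg NNReal.toReal h)

lemma ae_position_ne_const (i : PointIndex d) (a : Fin d) (c : ℝ≥0) :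
    ∀ᵐ ω ∂(poissonProcess d), position ω i a ≠ c := by
  have h : ∀ᵐ x : unitInterval, (i.1 a : ℝ≥0) + unitInterval.toNNReal x ≠ c := by
    rw [ae_iff]
    simp only [not_not]
    exact (subsingleton_add_toNNReal_eq _ _).measure_zero _
  rw [← (hasLaw_relCoordinate i a).map_eq] at h
  exact ae_of_ae_map (hasLaw_relCoordinate i a).aemeasurable h

/-- Independent uniform variables, even after translation, almost surely differ. -/
lemma ae_add_toNNReal_ne {Ω : Type*} [MeasurableSpace Ω] {P : Measure Ω} [IsProbabilityMeasure P]
    {X Y : Ω → unitInterval} (hXY : IndepFun X Y P) (hX : HasLaw X volume P)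
    (hY : HasLaw Y volume P) (c c' : ℝ≥0) :
    ∀ᵐ ω ∂P, c + unitInterval.toNNReal (X ω) ≠ c' + unitInterval.toNNReal (Y ω) := by
  have hm := measurable_unitInterval_toNNReal
  have h : ∀ᵐ z ∂((volume : Measure unitInterval).prod (volume : Measure unitInterval)),
      c + unitInterval.toNNReal z.1 ≠ c' + unitInterval.toNNReal z.2 := by
    have hmeas : MeasurableSet {z : unitInterval × unitInterval |
        c + unitInterval.toNNReal z.1 = c' + unitInterval.toNNReal z.2} :=
      measurableSet_eq_fun (by fun_prop) (by fun_prop)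
    rw [ae_iff]
    simp only [not_not]
    rw [Measure.measure_prod_null hmeas]
    refine .of_forall fun x => ?_
    simp only [Set.preimage_ofPred_eq]
    refine Set.Subsingleton.measure_zero ?_ _
    intro y hy y' hy'
    exact subsingleton_add_toNNReal_eq c' _ (Eq.symm hy) (Eq.symm hy')
  have hlaw := (indepFun_iff_hasLaw_prodMk_prod hX hY).1 hXY
  rw [← hlaw.map_eq] at h
  exact ae_of_ae_map hlaw.aemeasurable h

/-- Almost surely, no coordinate is shared by two potential points of a Poisson process, or by two
axes. -/
lemma ae_position_injective : ∀ᵐ ω ∂(poissonProcess d),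
    Function.Injective fun x : PointIndex d × Fin d => position ω x.1 x.2 := by
  have h : ∀ᵐ ω ∂(poissonProcess d), ∀ x y : PointIndex d × Fin d, x ≠ y →
      position ω x.1 x.2 ≠ position ω y.1 y.2 := by
    rw [ae_all_iff]
    intro x
    rw [ae_all_iff]
    rintro y
    rw [ae_all_iff]
    intro hxy
    obtain ⟨i, a⟩ := x
    obtain ⟨i', a'⟩ := y
    refine ae_add_toNNReal_ne ?_ (hasLaw_relCoordinate i a) (hasLaw_relCoordinate i' a') _ _
    by_cases hi : i = i'
    · subst hi
      have ha : a ≠ a' := fun e => hxy (by rw [e])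
      have hpi : iIndepFun (fun (a : Fin d) (ω : PoissonSpace d) => (ω i.1).2 i.2 a)
          (poissonProcess d) :=
        (iIndepFun_iff_hasLaw_pi_pi fun a => hasLaw_relCoordinate i a).2 (hasLaw_relPosition i)
      exact hpi.indepFun ha
    · exact (iIndepFun_relPosition.indepFun hi).comp (measurable_pi_apply a)
        (measurable_pi_apply a')
  filter_upwards [h] with ω hω x y hxy
  by_contra hne
  exact hω x y hne hxy

end PoissonDistinct

/-! ### The graphex with a diagonal graphon -/

section DiagGraphex

lemma lebesgue_apply_singleton (x : ℝ≥0) : lebesgue {x} = 0 := by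
  rw [lebesgue, Measure.comap_apply _ NNReal.coe_injective]
  · simp
  · intro s hs
    exact (MeasurableEmbedding.subtype_coe measurableSet_Ici).measurableSet_image.2 hs
  · exact measurableSet_singleton x

lemma lebesgue_Iic (l : ℝ≥0) : lebesgue (Set.Iic l) ≤ l := by
  rw [lebesgue, Measure.comap_apply _ NNReal.coe_injective]
  · refine (measure_mono (t := Set.Icc 0 (l : ℝ)) ?_).trans ?_
    · rintro _ ⟨x, hx, rfl⟩
      exact ⟨x.2, hx⟩
    · simp
  · intro s hs
    exact (MeasurableEmbedding.subtype_coe measurableSet_Ici).measurableSet_image.2 hs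
  · exact measurableSet_Iic

instance : SigmaFinite lebesgue :=
  ⟨⟨⟨fun n => Set.Iic (n : ℝ≥0), fun _ => trivial,
    fun n => (lebesgue_Iic n).trans_lt ENNReal.coe_lt_top,
    Set.eq_univ_of_forall fun x => Set.mem_iUnion.2 ((exists_nat_ge x))⟩⟩⟩

open scoped Classical in
/-- The graphon that is the indicator function of the diagonal over `[0, l]`. -/
def diagGraphon (l : ℝ≥0) (x y : ℝ≥0) : unitInterval :=
  if x = y ∧ x ≤ l then 1 else 0

lemma diagGraphon_of_ne (l : ℝ≥0) {x y : ℝ≥0} (h : x ≠ y) : diagGraphon l x y = 0 :=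
  if_neg fun h' => h h'.1

lemma measurable_diagGraphon (l : ℝ≥0) : Measurable (Function.uncurry (diagGraphon l)) := by
  refine Measurable.ite (MeasurableSet.inter ?_ ?_) measurable_const measurable_const
  · exact measurableSet_eq_fun measurable_fst measurable_snd
  · exact measurable_fst measurableSet_Iic

lemma graphonMarginal_diagGraphon (l y : ℝ≥0) : graphonMarginal (diagGraphon l) y = 0 := by
  rw [graphonMarginal, lintegral_eq_zero_iff']
  · have h : ∀ᵐ x ∂lebesgue, x ≠ y := by
      rw [ae_iff]
      simpa using lebesgue_apply_singleton y
    filter_upwards [h] with x hx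
    simp [diagGraphon_of_ne l hx]
  · have h := measurable_diagGraphon l
    have h2 : Measurable fun x => Function.uncurry (diagGraphon l) (x, y) := by fun_prop
    exact (ENNReal.measurable_ofReal.comp (measurable_subtype_coe.comp h2)).aemeasurable

/-- The graphex `(1/2, 0, W)`, where `W` is the indicator function of the diagonal over
`[0, l]`. -/
def diagGraphex (l : ℝ≥0) : Graphex where
  I := 1 / 2
  S _ := 0
  W := diagGraphon l
  measurable_S := measurable_const
  integrable_min_S := by simp
  measurable_W := measurable_diagGraphon l
  symm_W x y := by
    by_cases h : x = y
    · rw [h]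
    · rw [diagGraphon_of_ne l h, diagGraphon_of_ne l (Ne.symm h)]
  marginal_finite := by simp [graphonMarginal_diagGraphon]
  marginal_large := by simp [graphonMarginal_diagGraphon]
  integrable_small := by
    simp only [graphonMarginal_diagGraphon, zero_le, and_self, Set.ofPred_true,
      Measure.restrict_univ]
    have hm : Measurable fun z : ℝ≥0 × ℝ≥0 => ENNReal.ofReal (diagGraphon l z.1 z.2) :=
      ENNReal.measurable_ofReal.comp (measurable_subtype_coe.comp (measurable_diagGraphon l))
    rw [lintegral_prod_symm _ hm.aemeasurable]
    have h : ∀ y, ∫⁻ x, ENNReal.ofReal (diagGraphon l x y) ∂lebesgue = 0 :=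
      graphonMarginal_diagGraphon l
    simp [h]
  integrable_diag := by
    have h : ∀ x, ENNReal.ofReal (diagGraphon l x x) = (Set.Iic l).indicator 1 x := by
      intro x
      by_cases hx : x ≤ l <;> simp [diagGraphon, hx]
    simp_rw [h]
    rw [lintegral_indicator_one measurableSet_Iic]
    exact (lebesgue_Iic l).trans_lt ENNReal.coe_lt_top

/-- The randomness of the graphex process is in general position: its positions do not coincide,
as far as the graph of a diagonal graphex depends on this, and no threshold variable is `0`, which
would create an edge even where `S` or `W` vanishes. All potential points are considered, whether or
not they are points of the process. -/
structure GeneralPosition (ω : GraphexSpace) : Prop where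
  injective_vertices : Function.Injective fun x : PointIndex 2 × Fin 2 => position ω.1 x.1 x.2
  injective_edges : Function.Injective fun x : PointIndex 3 × Fin 3 => position ω.2.2.1 x.1 x.2
  vertex_ne_edge : ∀ (i : PointIndex 2) (k : PointIndex 3) (a : Fin 3),
    position ω.1 i 0 ≠ position ω.2.2.1 k a
  uniform_ne_zero : ∀ z, ω.2.2.2 z ≠ 0
  star_ne_zero : ∀ j k, position (ω.2.1 j) k 1 ≠ 0

instance : IsProbabilityMeasure graphexProb := by
  unfold graphexProb
  infer_instance

lemma ae_generalPosition : ∀ᵐ ω ∂graphexProb, GeneralPosition ω := by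
  have h1 : ∀ᵐ ω ∂graphexProb, Function.Injective fun x : PointIndex 2 × Fin 2 =>
      position ω.1 x.1 x.2 :=
    Measure.quasiMeasurePreserving_fst.ae ae_position_injective
  have h2 : ∀ᵐ ω ∂graphexProb, Function.Injective fun x : PointIndex 3 × Fin 3 =>
      position ω.2.2.1 x.1 x.2 :=
    Measure.quasiMeasurePreserving_snd.ae (Measure.quasiMeasurePreserving_snd.ae
      (Measure.quasiMeasurePreserving_fst.ae ae_position_injective))
  have h3 : ∀ᵐ ω ∂graphexProb, ∀ (i : PointIndex 2) (k : PointIndex 3) (a : Fin 3),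
      position ω.1 i 0 ≠ position ω.2.2.1 k a := by
    simp_rw [ae_all_iff]
    intro i k a
    have hmeas : MeasurableSet {ω : GraphexSpace | position ω.1 i 0 = position ω.2.2.1 k a} :=
      measurableSet_eq_fun ((measurable_position i 0).comp measurable_fst)
        ((measurable_position k a).comp
          (measurable_fst.comp (measurable_snd.comp measurable_snd)))
    rw [ae_iff]
    simp only [not_not]
    rw [graphexProb, Measure.measure_prod_null hmeas]
    refine .of_forall fun ω₁ => ?_
    have h := (Measure.quasiMeasurePreserving_snd
        (μ := Measure.infinitePi fun _ : PointIndex 2 => poissonProcess 2)).ae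
      ((Measure.quasiMeasurePreserving_fst (ν := Measure.infinitePi fun _ :
        Sym2 (PointIndex 2) => (volume : Measure unitInterval))).ae
          (ae_position_ne_const k a (position ω₁ i 0)))
    rw [ae_iff] at h
    simp only [not_not] at h
    simp only [Set.preimage_ofPred_eq, eq_comm (a := position ω₁ i 0)]
    exact h
  have h4 : ∀ᵐ ω ∂graphexProb, ∀ z, ω.2.2.2 z ≠ 0 := by
    simp_rw [ae_all_iff]
    intro z
    have h : ∀ᵐ ω ∂(Measure.infinitePi fun _ :
        Sym2 (PointIndex 2) => (volume : Measure unitInterval)), ω z ≠ 0 := by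
      have h0 : ∀ᵐ x : unitInterval, x ≠ 0 := by
        rw [ae_iff]
        simp
      rw [← Measure.infinitePi_map_eval (fun _ : Sym2 (PointIndex 2) =>
        (volume : Measure unitInterval)) z] at h0
      exact ae_of_ae_map (measurable_pi_apply z).aemeasurable h0
    exact Measure.quasiMeasurePreserving_snd.ae (Measure.quasiMeasurePreserving_snd.ae
      (Measure.quasiMeasurePreserving_snd.ae h))
  have h5 : ∀ᵐ ω ∂graphexProb, ∀ j k, position (ω.2.1 j) k 1 ≠ 0 := by
    simp_rw [ae_all_iff]
    intro j k
    have h : ∀ᵐ ω ∂(Measure.infinitePi fun _ : PointIndex 2 => poissonProcess 2),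
        position (ω j) k 1 ≠ 0 := by
      have h0 := ae_position_ne_const (d := 2) k 1 0
      rw [← Measure.infinitePi_map_eval (fun _ : PointIndex 2 => poissonProcess 2) j] at h0
      exact ae_of_ae_map (measurable_pi_apply j).aemeasurable h0
    exact Measure.quasiMeasurePreserving_snd.ae (Measure.quasiMeasurePreserving_fst.ae h)
  filter_upwards [h1, h2, h3, h4, h5] with ω h1 h2 h3 h4 h5
  exact ⟨h1, h2, h3, h4, h5⟩

namespace GeneralPosition

variable {ω : GraphexSpace}

/-- In general position, the graph of the diagonal graphex has a loop at each point `(θ, ϑ)` with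
`ϑ ≤ l`, an edge for each point `(ρ, ρ', η)` with `η ≤ 1 / 2`, and nothing else. -/
lemma adj_iff (hω : GeneralPosition ω) (l x y : ℝ≥0) :
    ((diagGraphex l).labeledGraph ω).Adj x y ↔
      (∃ i, IsPoint ω.1 i ∧ position ω.1 i 1 ≤ l ∧ x = position ω.1 i 0 ∧
        y = position ω.1 i 0) ∨
      ∃ k, IsPoint ω.2.2.1 k ∧ position ω.2.2.1 k 2 ≤ 1 / 2 ∧
        ((x = position ω.2.2.1 k 0 ∧ y = position ω.2.2.1 k 1) ∨
          (x = position ω.2.2.1 k 1 ∧ y = position ω.2.2.1 k 0)) := by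
  have hstar : ∀ x y, ¬ (diagGraphex l).starEdge ω x y := by
    rintro x y ⟨j, k, _, _, h, _⟩
    exact hω.star_ne_zero j k (le_antisymm h zero_le)
  simp only [Graphex.labeledGraph, hstar, false_or, or_false]
  refine or_congr ⟨?_, ?_⟩ ⟨?_, ?_⟩
  · rintro ⟨i, j, hi, hj, h, rfl, rfl⟩
    have hW : position ω.1 i 1 = position ω.1 j 1 ∧ position ω.1 i 1 ≤ l := by
      by_contra hcon
      have h0 : (diagGraphex l).W (position ω.1 i 1) (position ω.1 j 1) = 0 := if_neg hcon
      rw [h0] at h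
      exact hω.uniform_ne_zero _ (le_antisymm h unitInterval.nonneg')
    obtain rfl : i = j := congrArg Prod.fst (@hω.injective_vertices (i, 1) (j, 1) hW.1)
    exact ⟨i, hi, hW.2, rfl, rfl⟩
  · rintro ⟨i, hi, h, rfl, rfl⟩
    refine ⟨i, i, hi, hi, ?_, rfl, rfl⟩
    have h1 : (diagGraphex l).W (position ω.1 i 1) (position ω.1 i 1) = 1 := if_pos ⟨rfl, h⟩
    rw [h1]
    exact unitInterval.le_one'
  · rintro (⟨k, hk, h, rfl, rfl⟩ | ⟨k, hk, h, rfl, rfl⟩)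
    exacts [⟨k, hk, h, Or.inl ⟨rfl, rfl⟩⟩, ⟨k, hk, h, Or.inr ⟨rfl, rfl⟩⟩]
  · rintro ⟨k, hk, h, ⟨rfl, rfl⟩ | ⟨rfl, rfl⟩⟩
    exacts [Or.inl ⟨k, hk, h, rfl, rfl⟩, Or.inr ⟨k, hk, h, rfl, rfl⟩]

lemma vertex_inj (hω : GeneralPosition ω) {i j : PointIndex 2}
    (h : position ω.1 i 0 = position ω.1 j 0) : i = j :=
  congrArg Prod.fst (@hω.injective_vertices (i, 0) (j, 0) h)

lemma edge_inj (hω : GeneralPosition ω) {k k' : PointIndex 3} {a a' : Fin 3}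
    (h : position ω.2.2.1 k a = position ω.2.2.1 k' a') : k = k' ∧ a = a' :=
  Prod.mk.inj (@hω.injective_edges (k, a) (k', a') h)

/-- The loops of the diagonal graphex process at time `s`. -/
lemma loops_eq (hω : GeneralPosition ω) (l s : ℝ≥0) :
    {v | ((diagGraphex l).labeledGraph ω).Adj v v ∧ v ∈ Set.Iic s} =
      (fun i => position ω.1 i 0) '' pointsIn ![s, l] ω.1 := by
  ext v
  simp only [Set.mem_ofPred_eq, Set.mem_image, Set.mem_Iic, adj_iff hω, pointsIn,
    Fin.forall_fin_two, Matrix.cons_val_zero, Matrix.cons_val_one]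
  constructor
  · rintro ⟨⟨i, hi, h, rfl, -⟩ | ⟨k, -, -, ⟨h, h'⟩ | ⟨h, h'⟩⟩, hv⟩
    · exact ⟨i, ⟨hi, hv, h⟩, rfl⟩
    · exact absurd (hω.edge_inj (h.symm.trans h')).2 (by decide)
    · exact absurd (hω.edge_inj (h.symm.trans h')).2 (by decide)
  · rintro ⟨i, ⟨hi, hv, h⟩, rfl⟩
    exact ⟨Or.inl ⟨i, hi, h, rfl, rfl⟩, hv⟩

/-- The arcs of the diagonal graphex process at time `s`. -/
lemma arcs_eq (hω : GeneralPosition ω) (l s : ℝ≥0) :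
    {z : ℝ≥0 × ℝ≥0 | z.1 ≠ z.2 ∧ ((diagGraphex l).labeledGraph ω).Adj z.1 z.2 ∧
        z.1 ∈ Set.Iic s ∧ z.2 ∈ Set.Iic s} =
      (fun k => (position ω.2.2.1 k 0, position ω.2.2.1 k 1)) '' pointsIn ![s, s, 1 / 2] ω.2.2.1 ∪
        (fun k => (position ω.2.2.1 k 1, position ω.2.2.1 k 0)) ''
          pointsIn ![s, s, 1 / 2] ω.2.2.1 := by
  have hmem : ∀ k, k ∈ pointsIn ![s, s, 1 / 2] ω.2.2.1 ↔ IsPoint ω.2.2.1 k ∧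
      position ω.2.2.1 k 0 ≤ s ∧ position ω.2.2.1 k 1 ≤ s ∧ position ω.2.2.1 k 2 ≤ 1 / 2 := by
    intro k
    simp [pointsIn, Fin.forall_fin_succ]
  ext ⟨x, y⟩
  simp only [Set.mem_ofPred_eq, Set.mem_union, Set.mem_image, Set.mem_Iic, adj_iff hω, hmem,
    Prod.mk.injEq]
  constructor
  · rintro ⟨hne, ⟨i, -, -, rfl, h⟩ | ⟨k, hk, h, ⟨rfl, rfl⟩ | ⟨rfl, rfl⟩⟩, hx, hy⟩
    · exact absurd h.symm hne
    · exact Or.inl ⟨k, ⟨hk, hx, hy, h⟩, rfl, rfl⟩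
    · exact Or.inr ⟨k, ⟨hk, hy, hx, h⟩, rfl, rfl⟩
  · rintro (⟨k, ⟨hk, hx, hy, h⟩, rfl, rfl⟩ | ⟨k, ⟨hk, hx, hy, h⟩, rfl, rfl⟩)
    · exact ⟨fun e => absurd (hω.edge_inj e).2 (by decide),
        Or.inr ⟨k, hk, h, Or.inl ⟨rfl, rfl⟩⟩, hx, hy⟩
    · exact ⟨fun e => absurd (hω.edge_inj e).2 (by decide),
        Or.inr ⟨k, hk, h, Or.inr ⟨rfl, rfl⟩⟩, hy, hx⟩

lemma finite_nonIsolated (hω : GeneralPosition ω) (l s : ℝ≥0) :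
    (((diagGraphex l).labeledGraph ω).nonIsolated (Set.Iic s)).Finite := by
  have hl : {v | ((diagGraphex l).labeledGraph ω).Adj v v ∧ v ∈ Set.Iic s}.Finite := by
    rw [loops_eq hω]
    exact (finite_pointsIn _ _).image _
  have ha : {z : ℝ≥0 × ℝ≥0 | z.1 ≠ z.2 ∧ ((diagGraphex l).labeledGraph ω).Adj z.1 z.2 ∧
      z.1 ∈ Set.Iic s ∧ z.2 ∈ Set.Iic s}.Finite := by
    rw [arcs_eq hω]
    exact ((finite_pointsIn _ _).image _).union ((finite_pointsIn _ _).image _)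
  refine (hl.union (ha.image Prod.fst)).subset ?_
  rintro v ⟨hv, u, hu, hvu⟩
  by_cases huv : v = u
  · subst huv
    exact Or.inl ⟨hvu, hv⟩
  · exact Or.inr ⟨(v, u), ⟨huv, hvu, hv, hu⟩, rfl⟩

lemma isDisjointEdgesLoops_restrict (hω : GeneralPosition ω) (l s : ℝ≥0) :
    (((diagGraphex l).labeledGraph ω).restrict (Set.Iic s)).IsDisjointEdgesLoops := by
  refine LoopGraph.isDisjointEdgesLoops_restrict fun v _ u _ w _ hu hw => ?_
  rw [adj_iff hω] at hu hw
  rcases hu with ⟨i, -, -, rfl, rfl⟩ | ⟨k, -, -, hu⟩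
  · rcases hw with ⟨j, -, -, hw, rfl⟩ | ⟨k, -, -, ⟨hw, -⟩ | ⟨hw, -⟩⟩
    · exact hw
    · exact absurd hw (hω.vertex_ne_edge _ _ _)
    · exact absurd hw (hω.vertex_ne_edge _ _ _)
  · rcases hw with ⟨j, -, -, rfl, -⟩ | ⟨k', -, -, hw⟩
    · rcases hu with ⟨hu, -⟩ | ⟨hu, -⟩ <;> exact absurd hu (hω.vertex_ne_edge _ _ _)
    · rcases hu with ⟨rfl, rfl⟩ | ⟨rfl, rfl⟩ <;> rcases hw with ⟨hw, rfl⟩ | ⟨hw, rfl⟩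
      · rw [(hω.edge_inj hw).1]
      · exact absurd (hω.edge_inj hw).2 (by decide)
      · exact absurd (hω.edge_inj hw).2 (by decide)
      · rw [(hω.edge_inj hw).1]

lemma numLoops_restrict (hω : GeneralPosition ω) (l s : ℝ≥0) :
    (((diagGraphex l).labeledGraph ω).restrict (Set.Iic s)).numLoops =
      (pointsIn ![s, l] ω.1).ncard := by
  rw [LoopGraph.numLoops_restrict, loops_eq hω,
    Set.ncard_image_of_injective _ fun _ _ h => hω.vertex_inj h]

lemma numEdges_restrict (hω : GeneralPosition ω) (l s : ℝ≥0) :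
    (((diagGraphex l).labeledGraph ω).restrict (Set.Iic s)).numEdges =
      (pointsIn ![s, s, 1 / 2] ω.2.2.1).ncard := by
  have := (hω.finite_nonIsolated l s).to_subtype
  have h : (((diagGraphex l).labeledGraph ω).restrict (Set.Iic s)).numArcs =
      2 * (pointsIn ![s, s, 1 / 2] ω.2.2.1).ncard := by
    rw [LoopGraph.numArcs_restrict, arcs_eq hω, Set.ncard_union_eq ?_
        ((finite_pointsIn _ _).image _) ((finite_pointsIn _ _).image _),
      Set.ncard_image_of_injective _ fun _ _ h => (hω.edge_inj (Prod.mk.inj h).1).1,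
      Set.ncard_image_of_injective _ fun _ _ h => (hω.edge_inj (Prod.mk.inj h).1).1, two_mul]
    · rw [Set.disjoint_left]
      rintro _ ⟨k, -, rfl⟩ ⟨k', -, h⟩
      exact absurd (hω.edge_inj (Prod.mk.inj h).1).2 (by decide)
  rw [LoopGraph.numArcs_eq_two_mul_numEdges] at h
  omega

lemma unlabeledAt_eq (hω : GeneralPosition ω) (l s : ℝ≥0) :
    (diagGraphex l).unlabeledAt s ω = UnlabeledGraph.ofEdgesLoops
      ((pointsIn ![s, s, 1 / 2] ω.2.2.1).ncard, (pointsIn ![s, l] ω.1).ncard) := by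
  have := (hω.finite_nonIsolated l s).to_subtype
  rw [← hω.numEdges_restrict l s, ← hω.numLoops_restrict l s,
    ← UnlabeledGraph.edgesLoops_unlabel, UnlabeledGraph.ofEdgesLoops_edgesLoops]
  · rfl
  · exact UnlabeledGraph.isDisjointEdgesLoops_unlabel (hω.isDisjointEdgesLoops_restrict l s)

end GeneralPosition

/-- At time `s`, the diagonal graphex process is a disjoint union of independent Poisson numbers of
edges and of loops. -/
lemma processDist_diagGraphex (l s : ℝ≥0) :
    (diagGraphex l).processDist s =
      ((poissonMeasure (s ^ 2 / 2)).prod (poissonMeasure (s * l))).map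
        UnlabeledGraph.ofEdgesLoops := by
  have hE : HasLaw (fun ω : GraphexSpace => (pointsIn ![s, s, 1 / 2] ω.2.2.1).ncard)
      (poissonMeasure (s ^ 2 / 2)) graphexProb := by
    have h := hasLaw_ncard_pointsIn ![s, s, 1 / 2]
    have hr : ∏ a, ![s, s, 1 / 2] a = s ^ 2 / 2 := by
      rw [Fin.prod_univ_three]
      simp only [Matrix.cons_val]
      ring
    rw [hr] at h
    exact h.fun_comp (X := fun ω : GraphexSpace => ω.2.2.1)
      ⟨by fun_prop, by
        have := (measurePreserving_fst (μ := poissonProcess 3)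
          (ν := Measure.infinitePi fun _ : Sym2 (PointIndex 2) =>
            (volume : Measure unitInterval))).comp
          ((measurePreserving_snd (μ := Measure.infinitePi fun _ : PointIndex 2 =>
            poissonProcess 2)).comp (measurePreserving_snd (μ := poissonProcess 2)))
        exact this.map_eq⟩
  have hL : HasLaw (fun ω : GraphexSpace => (pointsIn ![s, l] ω.1).ncard)
      (poissonMeasure (s * l)) graphexProb := by
    have h := hasLaw_ncard_pointsIn ![s, l]
    have hr : ∏ a, ![s, l] a = s * l := by
      rw [Fin.prod_univ_two]
      rfl
    rw [hr] at h
    exact h.fun_comp (X := fun ω : GraphexSpace => ω.1)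
      ⟨by fun_prop, measurePreserving_fst.map_eq⟩
  have hind : IndepFun (fun ω : GraphexSpace => (pointsIn ![s, s, 1 / 2] ω.2.2.1).ncard)
      (fun ω : GraphexSpace => (pointsIn ![s, l] ω.1).ncard) graphexProb :=
    (indepFun_prod (X := fun ω₁ : PoissonSpace 2 => (pointsIn ![s, l] ω₁).ncard)
      (Y := fun ω₂ : (PointIndex 2 → PoissonSpace 2) × PoissonSpace 3 ×
        (Sym2 (PointIndex 2) → unitInterval) => (pointsIn ![s, s, 1 / 2] ω₂.2.1).ncard)
      (measurable_ncard_pointsIn _)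
      ((measurable_ncard_pointsIn _).comp (measurable_fst.comp measurable_snd))).symm
  have hlaw := (indepFun_iff_hasLaw_prodMk_prod hE hL).1 hind
  have hae : (diagGraphex l).unlabeledAt s =ᵐ[graphexProb] fun ω => UnlabeledGraph.ofEdgesLoops
      ((pointsIn ![s, s, 1 / 2] ω.2.2.1).ncard, (pointsIn ![s, l] ω.1).ncard) := by
    filter_upwards [ae_generalPosition] with ω hω
    exact hω.unlabeledAt_eq l s
  -- This also makes `unlabeledAt s` almost everywhere measurable, without which its image measure
  -- would be zero by convention.
  rw [Graphex.processDist, Measure.map_congr hae, ← hlaw.map_eq,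
    AEMeasurable.map_map_of_aemeasurable Measurable.of_discrete.aemeasurable hlaw.aemeasurable]
  rfl

end DiagGraphex

/-! ### Convergence to the diagonal graphex -/

theorem mainTheorem8 {V : ℕ → Type*} [∀ j, Fintype (V j)] (G : ∀ j, LoopGraph (V j))
    (hG : SamplingConvergent G)
    (he : Tendsto (fun j => (G j).numEdges) atTop atTop)
    (hdeg : (fun j => ((G j).maxDegree : ℝ)) =o[atTop] (fun j => √((G j).numEdges : ℝ)) ∨
      Tendsto (fun j => (G j).avgSqDegree / (G j).avgDegree ^ 2 * √(G j).edgeDensity)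
        atTop (𝓝 0)) :
    (∃ 𝒲 : Graphex, 𝒲.I = 1 / 2 ∧ (∀ x, 𝒲.S x = 0) ∧ (∀ x y, x ≠ y → 𝒲.W x y = 0) ∧
      SamplingConvergentTo G 𝒲) ∧
    ∀ r : ℝ≥0, Tendsto
      (fun j => samplingDist (G j) r {H : UnlabeledGraph | H.IsDisjointEdgesLoops})
      atTop (𝓝 1) := by
  have hS := tendsto_sumSqDegree G he hdeg
  obtain ⟨l, hl⟩ := exists_tendsto_numLoops G hG he
  refine ⟨⟨diagGraphex l, rfl, fun _ => rfl, fun x y h => diagGraphon_of_ne l h, fun s => ?_⟩,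
    fun r => ?_⟩
  · obtain ⟨Q, hQ⟩ := hG s
    refine ⟨Q, ?_, hQ⟩
    have h0 : (Q : Measure UnlabeledGraph).real {H | ¬ H.IsDisjointEdgesLoops} = 0 :=
      tendsto_nhds_unique (tendsto_measureReal_of_discrete hQ _)
        (tendsto_samplingDist_disjoint he hS hl s)
    have hae : (UnlabeledGraph.ofEdgesLoops ∘ UnlabeledGraph.edgesLoops) =ᵐ[
        (Q : Measure UnlabeledGraph)] id := by
      have h1 : ∀ᵐ H ∂(Q : Measure UnlabeledGraph), H.IsDisjointEdgesLoops := by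
        rw [ae_iff]
        exact (measureReal_eq_zero_iff).1 h0
      filter_upwards [h1] with H hH
      exact UnlabeledGraph.ofEdgesLoops_edgesLoops hH
    rw [processDist_diagGraphex, ← map_edgesLoops_limit he hS hl s hQ,
      Measure.map_map .of_discrete .of_discrete, Measure.map_congr hae, Measure.map_id]
  · have h1 : Tendsto (fun j => 1 - (samplingDist (G j) r : Measure UnlabeledGraph).real
        {H | ¬ H.IsDisjointEdgesLoops}) atTop (𝓝 1) := by
      simpa using (tendsto_samplingDist_disjoint he hS hl r).const_sub 1
    rw [← NNReal.tendsto_coe]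
    refine h1.congr fun j => ?_
    have h2 := probReal_compl_eq_one_sub (μ := (samplingDist (G j) r : Measure UnlabeledGraph))
      (s := {H | ¬ H.IsDisjointEdgesLoops}) .of_discrete
    rw [← h2]
    simp only [Set.compl_ofPred, not_not]
    rfl

end
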